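/- **Setting.** Let $\Omega\subset\mathbb R^3$ be a bounded Lipschitz domain that is simply connected and has connected boundary. Let $w:\overline\Omega\times\mathbb R^3\to\mathbb R$ be piecewise continuous in $x$, with $w(x,\cdot)\in C^2(\mathbb R^3)$, $|w(x,0)|+|\partial_b w(x,0)|$ bounded uniformly in $x$, and $$\gamma|\xi|^2\le\langle\partial_{bb}w(x,\eta)\xi,\xi\rangle\le L|\xi|^2\qquad\forall x\in\overline\Omega,\ \xi,\eta\in\mathbb R^3,$$ with constants $\gamma,L>0$. Assume in addition that $|\partial_{bb}w(x,b_1)-\partial_{bb}w(x,b_2)|\le L''|b_1-b_2|$ for all $x\in\overline\Omega$ and $b_1,b_2\in\mathbb R^3$ (operator norm, $L''\ge0$). Let $\mathcal T_h$ be a geometrically conforming finite partition of $\Omega$ into closed tetrahedra $T$ which is shape-regular: $\operatorname{diam}T\le\kappa\,\rho$ for the diameter $\rho$ of some ball contained in $T$. Put $h_{\min}=\min_T\operatorname{diam}T$. Let $k\ge0$, let $\hat x_j$ be points of the closed reference tetrahedron and $\hat w_j>0$ weights, and let $x_{T,j}$ be the images of $\hat x_j$ under the affine maps onto the elements, such that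 $$\langle u,v\rangle_h:=\sum_{T}\sum_j u(x_{T,j})\cdot v(x_{T,j})\,\hat w_j|T|$$ equals $\int_\Omega u\cdot v\,dx$ for all piecewise polynomials $u,v\in P_k(\mathcal T_h)^3$. Let $W_h=\mathcal N_k(\mathcal T_h)\cap H_0(\operatorname{curl};\Omega)$ be the Nédélec space of the first kind (local space $P_k^3+x\times\widetilde P_k^3$, where $\widetilde P_k$ is the space of homogeneous polynomials of degree $k$), let $S_h=P_{k+1}(\mathcal T_h)\cap H^1_0(\Omega)$, and let $V_h$ be a subspace with $W_h=\nabla S_h\oplus V_h$ and $\|v_h\|_{H(\operatorname{curl})}\le C_*\|\operatorname{curl}v_h\|_{L^2(\Omega)}$ on $V_h$ for some $C_*>0$. Let $h_s\in H(\operatorname{curl};\Omega)\cap H^2(\mathcal T_h)^3$. Values at the points $x_{T,j}$ are taken from the element $T$. Let $a_h\in V_h$ be the minimizer over $V_h$ of the discrete energy $W(v_h)=\langle w(\operatorname{curl}v_h),1\rangle_h-\langle h_s,\operatorname{curl}v_h\rangle_h$. Let $0<\rho\le\frac12$, $0<\sigma<\frac12$. The damped Newton method starts from some $a_h^0\in V_h$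 and sets $a_h^{n+1}=a_h^n+\tau^n\delta a_h^n$, where $\delta a_h^n\in V_h$ satisfies $$\langle\partial_{bb}w(\operatorname{curl}a_h^n)\operatorname{curl}\delta a_h^n,\operatorname{curl}v_h\rangle_h=-\langle\partial_bw(\operatorname{curl}a_h^n)-h_s,\operatorname{curl}v_h\rangle_h\qquad\forall v_h\in V_h,$$ and $\tau^n$ is the largest number $\tau\in\{\rho^m:m\ge0\}$ with $W(a_h^n+\tau\,\delta a_h^n)\le W(a_h^n)+\sigma\tau\langle\partial_bw(\operatorname{curl}a_h^n)-h_s,\operatorname{curl}\delta a_h^n\rangle_h$. **Theorem 5 (local quadratic convergence).** There is a constant $C>0$, depending only on $k$ and the shape-regularity constant $\kappa$, and there is a radius $r>0$, depending only on $\Omega$, $k$, $\kappa$, $h_{\min}$, $\gamma$, $L$, $L''$, $\rho$ and $\sigma$, such that the following holds. Whenever $\|\operatorname{curl}(a_h^n-a_h)\|_{L^\infty(\Omega)}\le r$ for some $n\ge0$, the method takes the full step $\tau^n=1$, and $$\|\operatorname{curl}(a_h^{n+1}-a_h)\|_{L^2(\Omega)}\le C\,\frac{L''}{\gamma}\,h_{\min}^{-3/2}\,\|\operatorname{curl}(a_h^n-a_h)\|_{L^2(\Omega)}^2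 .$$ Moreover, in this case $\|\operatorname{curl}(a_h^m-a_h)\|_{L^\infty(\Omega)}\le r$ for all $m\ge n$ (so that full steps and the quadratic estimate persist), and $\|\operatorname{curl}(a_h^m-a_h)\|_{L^2(\Omega)}\to0$ as $m\to\infty$; i.e., the method converges locally quadratically. -/

import Mathlib

open MeasureTheory Filter Topology
open scoped ENNReal NNReal ContDiff

noncomputable section

namespace Magnetostatics

/-- Euclidean three-space. -/
abbrev E3 : Type := EuclideanSpace ℝ (Fin 3)

/-- The plane, used to parametrize Lipschitz boundaries. -/
abbrev E2 : Type := EuclideanSpace ℝ (Fin 2)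

/-! ### The domain -/

/-- Every boundary point has a neighbourhood in which, after an orthogonal change of coordinates,
the set is the region strictly above the graph of a Lipschitz function of two variables. -/
def HasLipschitzBoundary (Ω : Set E3) : Prop :=
  ∀ x ∈ frontier Ω, ∃ (e : E3 ≃ₗᵢ[ℝ] E3) (φ : E2 → ℝ) (K : ℝ≥0), LipschitzWith K φ ∧
    ∀ᶠ y in 𝓝 x, (y ∈ Ω ↔ φ !₂[e y 0, e y 1] < e y 2)

/-- Bounded Lipschitz domain of trivial topology: simply connected with connected boundary. -/
structure IsAdmissibleDomain (Ω : Set E3) : Prop where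
  isOpen : IsOpen Ω
  isBounded : Bornology.IsBounded Ω
  lipschitz : HasLipschitzBoundary Ω
  simplyConnected : SimplyConnectedSpace Ω
  connected_frontier : IsConnected (frontier Ω)

/-! ### Scalar products, norms and function spaces on open sets -/

/-- The norm `‖f‖` in `L²(Ω)`. -/
def l2Norm {F : Type*} [NormedAddCommGroup F] (Ω : Set E3) (f : E3 → F) : ℝ :=
  Real.sqrt (∫ x in Ω, ‖f x‖ ^ 2)

/-- The norm `‖f‖` in `L^∞(Ω)`, with values in `[0, ∞]`. -/
def linftyNorm {F : Type*} [NormedAddCommGroup F] (Ω : Set E3) (f : E3 → F) : ℝ≥0∞ :=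
  eLpNorm f ∞ (volume.restrict Ω)

/-- Square integrability over `Ω`. -/
def MemL2 {F : Type*} [NormedAddCommGroup F] (Ω : Set E3) (f : E3 → F) : Prop :=
  MemLp f 2 (volume.restrict Ω)

/-- Smooth functions with compact support in `Ω`. -/
structure IsTest {F : Type*} [NormedAddCommGroup F] [NormedSpace ℝ F]
    (Ω : Set E3) (φ : E3 → F) : Prop where
  smooth : ContDiff ℝ ∞ φ
  compact : HasCompactSupport φ
  support : tsupport φ ⊆ Ω

/-- The classical partial derivative in the coordinate direction `i`. -/
def partialDeriv {F : Type*} [NormedAddCommGroup F] [NormedSpace ℝ F]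
    (i : Fin 3) (φ : E3 → F) (x : E3) : F :=
  fderiv ℝ φ x (EuclideanSpace.single i 1)

/-- The classical curl; the index arithmetic is modulo three, so that the component `c` is
`∂_{c+1} φ_{c+2} - ∂_{c+2} φ_{c+1}`. -/
def curl (φ : E3 → E3) (x : E3) : E3 :=
  WithLp.toLp 2 fun c : Fin 3 =>
    partialDeriv (c + 1) φ x (c + 2) - partialDeriv (c + 2) φ x (c + 1)

/-- `g` is the weak curl of `u` on `Ω`. -/
def HasWeakCurl (Ω : Set E3) (u g : E3 → E3) : Prop :=
  ∀ φ : E3 → E3, IsTest Ω φ →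
    ∫ x in Ω, inner ℝ (u x) (curl φ x) = ∫ x in Ω, inner ℝ (g x) (φ x)

/-- `g` is the weak partial derivative of `u` on `Ω` in the coordinate direction `i`. -/
def HasWeakPartial (Ω : Set E3) (i : Fin 3) (u g : E3 → ℝ) : Prop :=
  ∀ φ : E3 → ℝ, IsTest Ω φ →
    ∫ x in Ω, u x * partialDeriv i φ x = - ∫ x in Ω, g x * φ x

/-- The space `H(curl; Ω)`. -/
def MemHCurl (Ω : Set E3) (u : E3 → E3) : Prop :=
  MemL2 Ω u ∧ ∃ g : E3 → E3, MemL2 Ω g ∧ HasWeakCurl Ω u g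

/-- The space `H₀(curl; Ω)`: the closure of the smooth compactly supported fields in
`H(curl; Ω)`. -/
def MemH0Curl (Ω : Set E3) (u : E3 → E3) : Prop :=
  MemL2 Ω u ∧ ∃ g : E3 → E3, MemL2 Ω g ∧ HasWeakCurl Ω u g ∧
    ∀ ε > 0, ∃ φ : E3 → E3, IsTest Ω φ ∧
      l2Norm Ω (fun x => u x - φ x) < ε ∧ l2Norm Ω (fun x => g x - curl φ x) < ε

/-- The space `H₀¹(Ω)`: the closure of the smooth compactly supported functions in `H¹(Ω)`. -/
def MemH01 (Ω : Set E3) (u : E3 → ℝ) : Prop :=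
  MemL2 Ω u ∧ ∃ g : Fin 3 → E3 → ℝ, (∀ i, MemL2 Ω (g i) ∧ HasWeakPartial Ω i u (g i)) ∧
    ∀ ε > 0, ∃ φ : E3 → ℝ, IsTest Ω φ ∧
      l2Norm Ω (fun x => u x - φ x) < ε ∧
      ∀ i, l2Norm Ω (fun x => g i x - partialDeriv i φ x) < ε

/-- The scalar Sobolev space `H^m(Ω)`. -/
def MemSobolev (Ω : Set E3) : ℕ → (E3 → ℝ) → Prop
  | 0, u => MemL2 Ω u
  | m + 1, u => MemL2 Ω u ∧ ∀ i : Fin 3, ∃ g : E3 → ℝ, HasWeakPartial Ω i u g ∧ MemSobolev Ω m g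

/-! ### The energy density -/

/-- The first derivative `∂_b w(x, b)`, as a vector. -/
def dw (w : E3 → E3 → ℝ) (x b : E3) : E3 := gradient (w x) b

/-- The second derivative `∂_bb w(x, b)`, as a linear operator. -/
def ddw (w : E3 → E3 → ℝ) (x b : E3) : E3 →L[ℝ] E3 := fderiv ℝ (gradient (w x)) b

/-- Piecewise continuity of `w(·, b)`: there are finitely many disjoint open pieces with null
boundaries whose closures cover the closure of `Ω`, and on each piece `w(·, b)` coincides with
a function that is continuous up to the boundary of the piece. -/
def IsPiecewiseContinuous (Ω : Set E3) (w : E3 → E3 → ℝ) : Prop :=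
  ∃ (m : ℕ) (D : Fin m → Set E3),
    (∀ i, IsOpen (D i) ∧ D i ⊆ Ω ∧ volume (frontier (D i)) = 0) ∧
    Pairwise (fun i j => Disjoint (D i) (D j)) ∧
    closure Ω ⊆ ⋃ i, closure (D i) ∧
    ∀ (b : E3) (i : Fin m), ∃ g : E3 → ℝ,
      ContinuousOn g (closure (D i)) ∧ Set.EqOn (fun x => w x b) g (D i)

/-- The conditions on the energy density `w` with ellipticity constants `γ` and `L`. -/
structure IsAdmissibleEnergy (Ω : Set E3) (γ L : ℝ) (w : E3 → E3 → ℝ) : Prop where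
  piecewise_continuous : IsPiecewiseContinuous Ω w
  contDiff : ∀ x ∈ closure Ω, ContDiff ℝ 2 (w x)
  bounded_at_zero : ∃ C : ℝ, ∀ x ∈ closure Ω, |w x 0| + ‖dw w x 0‖ ≤ C
  lower : ∀ x ∈ closure Ω, ∀ η ξ : E3, γ * ‖ξ‖ ^ 2 ≤ inner ℝ (ddw w x η ξ) ξ
  upper : ∀ x ∈ closure Ω, ∀ η ξ : E3, inner ℝ (ddw w x η ξ) ξ ≤ L * ‖ξ‖ ^ 2

/-- `∂_bb w` is Lipschitz continuous in the second argument with constant `M`, uniformly in the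
first one; matrices are measured in the operator norm. -/
def HasLipschitzHessian (Ω : Set E3) (M : ℝ) (w : E3 → E3 → ℝ) : Prop :=
  ∀ x ∈ closure Ω, ∀ b₁ b₂ : E3, ‖ddw w x b₁ - ddw w x b₂‖ ≤ M * ‖b₁ - b₂‖

/-! ### Tetrahedral meshes -/

/-- A geometrically conforming finite partition of `Ω` into nondegenerate closed tetrahedra: two
elements meet exactly in the (possibly empty) face spanned by their common vertices. The vertices
are numbered, which fixes the affine map from the reference element. -/
structure Mesh (Ω : Set E3) where
  N : ℕ
  tet : Fin N → Affine.Simplex ℝ E3 3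
  cover : ⋃ i, convexHull ℝ (Set.range (tet i).points) = closure Ω
  interior_subset : ∀ i, interior (convexHull ℝ (Set.range (tet i).points)) ⊆ Ω
  distinct : ∀ i j, i ≠ j → Set.range (tet i).points ≠ Set.range (tet j).points
  conforming : ∀ i j,
    convexHull ℝ (Set.range (tet i).points) ∩ convexHull ℝ (Set.range (tet j).points)
      = convexHull ℝ (Set.range (tet i).points ∩ Set.range (tet j).points)

namespace Mesh

variable {Ω : Set E3} (𝒯 : Mesh Ω)

/-- The closed tetrahedron with index `i`. -/
def cell (i : Fin 𝒯.N) : Set E3 := convexHull ℝ (Set.range (𝒯.tet i).points)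

/-- The volume of an element. -/
def cellVol (i : Fin 𝒯.N) : ℝ := (volume (𝒯.cell i)).toReal

/-- The affine map from the reference element onto the element with index `i`. -/
def refMap (i : Fin 𝒯.N) (y : E3) : E3 :=
  (𝒯.tet i).points 0 + ∑ c : Fin 3, y c • ((𝒯.tet i).points c.succ - (𝒯.tet i).points 0)

/-- The minimal element diameter. -/
def hMin : ℝ := ⨅ i, Metric.diam (𝒯.cell i)

/-- Shape regularity: the diameter of each element is at most `κ` times the diameter of some ball
contained in it. -/
def IsShapeRegular (κ : ℝ) : Prop :=
  ∀ i, ∃ (z : E3) (ρ : ℝ), 0 < ρ ∧ Metric.closedBall z ρ ⊆ 𝒯.cell i ∧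
    Metric.diam (𝒯.cell i) ≤ κ * (2 * ρ)

/-- The function on `Ω` which is given by `F i` in the interior of the element `i` (its values on
the element boundaries, a null set, are irrelevant and set to zero). -/
def glue {F : Type*} [AddCommMonoid F] (f : Fin 𝒯.N → E3 → F) (x : E3) : F :=
  ∑ i, (interior (𝒯.cell i)).indicator (f i) x

end Mesh

/-! ### Piecewise polynomial spaces -/

/-- Scalar polynomials in three variables. -/
abbrev Poly : Type := MvPolynomial (Fin 3) ℝ

/-- Polynomial vector fields in three variables. -/
abbrev PolyField : Type := Fin 3 → Poly

/-- The function defined by a polynomial. -/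
def polyFun (p : Poly) (x : E3) : ℝ := MvPolynomial.eval (fun j => x j) p

/-- The vector field defined by three polynomials. -/
def polyFieldFun (p : PolyField) (x : E3) : E3 := WithLp.toLp 2 fun c => polyFun (p c) x

/-- The curl of a polynomial vector field. -/
def polyCurl (p : PolyField) : PolyField := fun c =>
  MvPolynomial.pderiv (c + 1) (p (c + 2)) - MvPolynomial.pderiv (c + 2) (p (c + 1))

/-- The gradient of a polynomial. -/
def polyGrad (s : Poly) : PolyField := fun c => MvPolynomial.pderiv c s

/-- The local Nédélec space of the first kind: `P_k³ + x × (homogeneous P_k)³`. -/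
def IsNedelec (k : ℕ) (v : PolyField) : Prop :=
  ∃ p q : PolyField, (∀ c, (p c).totalDegree ≤ k) ∧ (∀ c, (q c).IsHomogeneous k) ∧
    v = p + crossProduct (fun j => (MvPolynomial.X j : Poly)) q

namespace Mesh

variable {Ω : Set E3} (𝒯 : Mesh Ω)

/-- Piecewise polynomial vector fields, without a bound on the degree. -/
abbrev PwField : Type := Fin 𝒯.N → PolyField

/-- The function on `Ω` defined by a piecewise polynomial vector field. -/
def fieldFun (v : 𝒯.PwField) : E3 → E3 := 𝒯.glue fun i => polyFieldFun (v i)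

/-- The elementwise curl. For fields in `H(curl; Ω)` this is the weak curl. -/
def pwCurl (v : 𝒯.PwField) : 𝒯.PwField := fun i => polyCurl (v i)

/-- The function `curl v` on `Ω`. -/
def curlFun (v : 𝒯.PwField) : E3 → E3 := 𝒯.fieldFun (𝒯.pwCurl v)

/-- The space `P_k(𝒯)³`. -/
def IsPwDegreeLE (k : ℕ) (v : 𝒯.PwField) : Prop := ∀ i c, (v i c).totalDegree ≤ k

/-- The space `W_h`: Nédélec elements of order `k` in `H₀(curl; Ω)`. -/
def nedelecSpace (k : ℕ) : Set 𝒯.PwField :=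
  {v | (∀ i, IsNedelec k (v i)) ∧ MemH0Curl Ω (𝒯.fieldFun v)}

/-- The space `S_h`: piecewise polynomials of degree at most `k + 1` in `H₀¹(Ω)`. -/
def lagrangeSpace (k : ℕ) : Set (Fin 𝒯.N → Poly) :=
  {s | (∀ i, (s i).totalDegree ≤ k + 1) ∧ MemH01 Ω (𝒯.glue fun i => polyFun (s i))}

/-- The elementwise gradient. -/
def pwGrad (s : Fin 𝒯.N → Poly) : 𝒯.PwField := fun i => polyGrad (s i)

/-- The space `V` is an admissible choice of `V_h`: the sum `W_h = ∇ S_h ⊕ V` is direct and the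
splitting is stable. -/
structure IsStableComplement (k : ℕ) (V : Submodule ℝ 𝒯.PwField) : Prop where
  sum : 𝒯.nedelecSpace k = {u | ∃ s ∈ 𝒯.lagrangeSpace k, ∃ v ∈ V, u = 𝒯.pwGrad s + v}
  direct : ∀ s ∈ 𝒯.lagrangeSpace k, 𝒯.pwGrad s ∈ V → 𝒯.pwGrad s = 0
  stable : ∃ Cs > 0, ∀ v ∈ V,
    Real.sqrt (l2Norm Ω (𝒯.fieldFun v) ^ 2 + l2Norm Ω (𝒯.curlFun v) ^ 2)
      ≤ Cs * l2Norm Ω (𝒯.curlFun v)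

/-- The source field belongs to `H(curl; Ω)` and is piecewise `H²`. On each element it is given by
its representative that is continuous up to the boundary of the element, so that it can be
evaluated at the integration points. -/
structure IsSource (hs : Fin 𝒯.N → E3 → E3) : Prop where
  continuousOn : ∀ i, ContinuousOn (hs i) (𝒯.cell i)
  piecewise_H2 : ∀ i, ∀ c : Fin 3, MemSobolev (interior (𝒯.cell i)) 2 fun x => hs i x c
  hCurl : MemHCurl Ω (𝒯.glue hs)

end Mesh

/-! ### Numerical quadrature -/

/-- A quadrature rule: points and weights. -/
structure QuadRule where
  card : ℕ
  pt : Fin card → E3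
  wt : Fin card → ℝ

/-- The closed reference tetrahedron. -/
def refTet : Set E3 := {y | (∀ c, 0 ≤ y c) ∧ ∑ c, y c ≤ 1}

namespace Mesh

variable {Ω : Set E3} (𝒯 : Mesh Ω) (Q : QuadRule)

/-- Elementwise numerical integration `∑_T ∑_j f_T(x_{T,j}) ŵ_j |T|` of a piecewise function. -/
def quad (f : Fin 𝒯.N → E3 → ℝ) : ℝ :=
  ∑ i, ∑ j, f i (𝒯.refMap i (Q.pt j)) * Q.wt j * 𝒯.cellVol i

/-- The discrete scalar product of piecewise vector fields. -/
def innerH (u v : Fin 𝒯.N → E3 → E3) : ℝ := 𝒯.quad Q fun i x => inner ℝ (u i x) (v i x)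

/-- The quadrature rule has points in the reference element and positive weights, and the discrete
scalar product is exact on `P_k(𝒯)³`. -/
structure IsAdmissibleRule (k : ℕ) : Prop where
  mem_refTet : ∀ j, Q.pt j ∈ refTet
  wt_pos : ∀ j, 0 < Q.wt j
  exact : ∀ u v : 𝒯.PwField, 𝒯.IsPwDegreeLE k u → 𝒯.IsPwDegreeLE k v →
    𝒯.innerH Q (fun i => polyFieldFun (u i)) (fun i => polyFieldFun (v i))
      = ∫ x in Ω, inner ℝ (𝒯.fieldFun u x) (𝒯.fieldFun v x)

/-! ### The discrete problem and the damped Newton method -/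

variable (w : E3 → E3 → ℝ) (hs : Fin 𝒯.N → E3 → E3)

/-- The elementwise function `curl v`, evaluated on the closed elements. -/
def curlOn (v : 𝒯.PwField) : Fin 𝒯.N → E3 → E3 := fun i => polyFieldFun (polyCurl (v i))

/-- The discrete energy `⟨w(curl v), 1⟩_h - ⟨h_s, curl v⟩_h`. -/
def energy (v : 𝒯.PwField) : ℝ :=
  𝒯.quad Q (fun i x => w x (𝒯.curlOn v i x)) - 𝒯.innerH Q hs (𝒯.curlOn v)

/-- `a` solves the discrete minimization problem over `V`. -/
def IsDiscreteSolution (V : Submodule ℝ 𝒯.PwField) (a : 𝒯.PwField) : Prop :=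
  a ∈ V ∧ ∀ v ∈ V, 𝒯.energy Q w hs a ≤ 𝒯.energy Q w hs v

/-- The derivative `⟨∂_b w(curl a) - h_s, curl v⟩_h` of the energy at `a` in direction `v`. -/
def residual (a v : 𝒯.PwField) : ℝ :=
  𝒯.innerH Q (fun i x => dw w x (𝒯.curlOn a i x) - hs i x) (𝒯.curlOn v)

/-- `δ` is the Newton increment at `a`. -/
def IsNewtonIncrement (V : Submodule ℝ 𝒯.PwField) (a δ : 𝒯.PwField) : Prop :=
  δ ∈ V ∧ ∀ v ∈ V,
    𝒯.innerH Q (fun i x => ddw w x (𝒯.curlOn a i x) (𝒯.curlOn δ i x)) (𝒯.curlOn v)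
      = - 𝒯.residual Q w hs a v

/-- `τ` is the step size selected by Armijo back-tracking with parameters `ρ` and `σ`. -/
def IsArmijoStep (ρ σ : ℝ) (a δ : 𝒯.PwField) (τ : ℝ) : Prop :=
  IsGreatest {t : ℝ | (∃ m : ℕ, t = ρ ^ m) ∧
    𝒯.energy Q w hs (a + t • δ) ≤ 𝒯.energy Q w hs a + σ * t * 𝒯.residual Q w hs a δ} τ

/-- The iterates `a n`, increments `δ n` and step sizes `τ n` are generated by the damped Newton
method with some initial value `a 0` in `V`. -/
structure IsDampedNewton (V : Submodule ℝ 𝒯.PwField) (ρ σ : ℝ)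
    (a δ : ℕ → 𝒯.PwField) (τ : ℕ → ℝ) : Prop where
  init : a 0 ∈ V
  increment : ∀ n, 𝒯.IsNewtonIncrement Q w hs V (a n) (δ n)
  step : ∀ n, 𝒯.IsArmijoStep Q w hs ρ σ (a n) (δ n) (τ n)
  update : ∀ n, a (n + 1) = a n + τ n • δ n

end Mesh

end Magnetostatics

end

/-!
Along directions in `V` the discrete energy is twice differentiable. Since the quadrature rule is
exact on products of polynomials of degree at most `k`, its node norm of `curl v` is the `L²` norm,
and with respect to this seminorm the second derivative is coercive with constant `γ`. Scaling the
equivalence of norms on polynomials to balls inside the elements gives the inverse estimate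
`‖curl v‖_∞ ≤ c ‖curl v‖_{L²}` with `c = C₀ h ^ (-3/2)`; one of the three factors in the difference
of two second derivatives is estimated in `L^∞`, so that the second derivative is Lipschitz with
constant `Λ = M c`.

For any functional of this kind the Newton error satisfies `p (a⁺ - a*) ≤ Λ / (2 γ) p (a - a*) ^ 2`,
and the third-order Taylor remainder is dominated by `(1/2 - σ) γ p δ ^ 2` near the minimizer, so
that back-tracking accepts the full step. Each such step at least halves the error. Applying the
inverse estimate once more to the quadratic bound keeps the iterates in the `L^∞` ball of radius
`r`.
-/

namespace Magnetostatics

section Polynomials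

open MvPolynomial

theorem totalDegree_pderiv_le {σ R : Type*} [CommSemiring R] (i : σ) (p : MvPolynomial σ R) :
    (pderiv i p).totalDegree ≤ p.totalDegree - 1 := by
  refine Finset.sup_le fun m hm => ?_
  rw [mem_support_iff, coeff_pderiv] at hm
  have hdeg := le_totalDegree (mem_support_iff.2 (left_ne_zero_of_mul hm))
  rw [Finsupp.sum_add_index' (fun _ => rfl) (fun _ _ _ => rfl), Finsupp.sum_single_index rfl]
    at hdeg
  omega

theorem totalDegree_bind₁_le {σ τ R : Type*} [CommSemiring R] {f : σ → MvPolynomial τ R} {n : ℕ}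
    (hf : ∀ j, (f j).totalDegree ≤ n) (p : MvPolynomial σ R) :
    (bind₁ f p).totalDegree ≤ p.totalDegree * n := by
  rw [bind₁, aeval_def, eval₂_eq]
  refine totalDegree_finsetSum_le fun m hm => ?_
  calc (algebraMap R (MvPolynomial τ R) (p.coeff m) * ∏ i ∈ m.support, f i ^ m i).totalDegree
      ≤ (∏ i ∈ m.support, f i ^ m i).totalDegree := by
        simpa [algebraMap_eq] using totalDegree_mul (C (p.coeff m)) (∏ i ∈ m.support, f i ^ m i)
    _ ≤ ∑ i ∈ m.support, m i * n :=
        (totalDegree_finsetProd _ _).trans <| Finset.sum_le_sum fun i _ =>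
          (totalDegree_pow _ _).trans (Nat.mul_le_mul_left _ (hf i))
    _ = (m.sum fun _ e => e) * n := (Finset.sum_mul _ _ _).symm
    _ ≤ p.totalDegree * n := Nat.mul_le_mul_right _ (le_totalDegree hm)

theorem continuous_eval_euclidean {ι : Type*} (p : MvPolynomial ι ℝ) :
    Continuous fun x : EuclideanSpace ℝ ι => eval x p :=
  (continuous_eval p).comp (PiLp.continuous_ofLp 2 _)

theorem exists_eval_eq_eval_add_smul {ι : Type*} (p : MvPolynomial ι ℝ)
    (z : EuclideanSpace ℝ ι) (ρ : ℝ) :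
    ∃ q : MvPolynomial ι ℝ, q.totalDegree ≤ p.totalDegree ∧
      ∀ y : EuclideanSpace ℝ ι, eval y q = eval (z + ρ • y) p := by
  refine ⟨bind₁ (fun j => C (z j) + C ρ * X j) p, ?_, fun y => ?_⟩
  · have hdeg (j : ι) : (C (z j) + C ρ * X j : MvPolynomial ι ℝ).totalDegree ≤ 1 :=
      (totalDegree_add _ _).trans <|
        max_le (by simp) ((totalDegree_mul _ _).trans (by simp [totalDegree_X]))
    simpa using totalDegree_bind₁_le hdeg p
  · rw [← aeval_eq_eval, ← aeval_eq_eval, aeval_bind₁]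
    congr 2
    ext j
    simp

theorem eq_zero_of_eval_ae_eq_zero {ι : Type*} [Fintype ι] {U : Set (EuclideanSpace ℝ ι)}
    (hU : IsOpen U) (hne : U.Nonempty) {p : MvPolynomial ι ℝ}
    (hp : (fun x : EuclideanSpace ℝ ι => eval x p) =ᵐ[volume.restrict U] 0) : p = 0 := by
  obtain ⟨z, hz⟩ := hne
  have hzero : Set.EqOn (fun x : EuclideanSpace ℝ ι => eval x p) 0 U :=
    Measure.eqOn_open_of_ae_eq hp hU (continuous_eval_euclidean p).continuousOn continuousOn_const
  have hanalytic := AnalyticOnNhd.eval_continuousLinearMap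
    (EuclideanSpace.equiv ι ℝ).toContinuousLinearMap p
  have heq := AnalyticOnNhd.eq_of_eventuallyEq hanalytic analyticOnNhd_const
    (hzero.eventuallyEq_of_mem (hU.mem_nhds hz))
  exact MvPolynomial.funext fun x => (congrFun heq (WithLp.toLp 2 x)).trans (map_zero _).symm

end Polynomials

section InverseEstimate

open MvPolynomial

theorem exists_norm_le_mul_norm_of_injective {𝕜 V E F : Type*} [NontriviallyNormedField 𝕜]
    [CompleteSpace 𝕜] [AddCommGroup V] [Module 𝕜 V] [FiniteDimensional 𝕜 V]
    [NormedAddCommGroup E] [NormedSpace 𝕜 E] [SeminormedAddCommGroup F] [NormedSpace 𝕜 F]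
    {f : V →ₗ[𝕜] E} (hf : Function.Injective f) (g : V →ₗ[𝕜] F) :
    ∃ C : ℝ, 0 < C ∧ ∀ v, ‖g v‖ ≤ C * ‖f v‖ := by
  let e := LinearEquiv.ofInjective f hf
  have : FiniteDimensional 𝕜 f.range := Module.Finite.equiv e
  let A : f.range →L[𝕜] F := (g ∘ₗ e.symm.toLinearMap).toContinuousLinearMap
  obtain ⟨C, hC, hA⟩ := A.bound
  exact ⟨C, hC, fun v => by simpa [A, e] using hA (e v)⟩

theorem integrableOn_of_isBounded {X F : Type*} [MetricSpace X] [ProperSpace X]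
    [MeasurableSpace X] [OpensMeasurableSpace X] {μ : Measure X} [IsFiniteMeasureOnCompacts μ]
    [NormedAddCommGroup F] {f : X → F} (hf : Continuous f) {s : Set X}
    (hs : Bornology.IsBounded s) : IntegrableOn f s μ :=
  (hf.continuousOn.integrableOn_compact hs.isCompact_closure).mono_set subset_closure

variable {ι : Type*} [Fintype ι]

theorem memLp_eval_restrict {U : Set (EuclideanSpace ℝ ι)} (hU : Bornology.IsBounded U)
    (p : MvPolynomial ι ℝ) :
    MemLp (fun x : EuclideanSpace ℝ ι => eval x p) 2 (volume.restrict U) :=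
  (memLp_two_iff_integrable_sq (continuous_eval_euclidean p).aestronglyMeasurable).2
    (integrableOn_of_isBounded ((continuous_eval_euclidean p).pow 2) hU)

/-- A polynomial of degree at most `k` as an element of `L²(U)`. -/
noncomputable def evalL2 {U : Set (EuclideanSpace ℝ ι)} (hU : Bornology.IsBounded U) (k : ℕ) :
    restrictTotalDegree ι ℝ k →ₗ[ℝ] Lp ℝ 2 (volume.restrict U) where
  toFun p := (memLp_eval_restrict hU p.1).toLp _
  map_add' p q := by
    rw [← MemLp.toLp_add]; congr 1; ext x; simp
  map_smul' t p := by
    rw [RingHom.id_apply, ← MemLp.toLp_const_smul]; congr 1; ext x; simp [smul_eval]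

theorem norm_evalL2_sq {U : Set (EuclideanSpace ℝ ι)} (hU : Bornology.IsBounded U) {k : ℕ}
    (p : restrictTotalDegree ι ℝ k) :
    ‖evalL2 hU k p‖ ^ 2 = ∫ x in U, eval x p.1 ^ 2 := by
  rw [← real_inner_self_eq_norm_sq, L2.inner_def]
  refine integral_congr_ae ?_
  filter_upwards [(memLp_eval_restrict hU p.1).coeFn_toLp] with x hx
  simp [evalL2, hx, sq]

theorem injective_evalL2 {U : Set (EuclideanSpace ℝ ι)} (hU : Bornology.IsBounded U)
    (hUo : IsOpen U) (hne : U.Nonempty) (k : ℕ) : Function.Injective (evalL2 hU k) := by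
  rw [injective_iff_map_eq_zero]
  intro p hp
  have hae := (memLp_eval_restrict hU p.1).coeFn_toLp.symm
  exact Subtype.ext <| eq_zero_of_eval_ae_eq_zero hUo hne <|
    hae.trans ((Lp.ext_iff.1 hp).trans (Lp.coeFn_zero ℝ 2 _))

/-- Polynomials of degree at most `k` as continuous functions on `K`. -/
noncomputable def evalOn (K : Set (EuclideanSpace ℝ ι)) (k : ℕ) :
    restrictTotalDegree ι ℝ k →ₗ[ℝ] C(K, ℝ) where
  toFun p := ⟨fun x => eval x.1 p.1, (continuous_eval_euclidean p.1).comp continuous_subtype_val⟩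
  map_add' p q := by ext x; simp
  map_smul' t p := by ext x; simp [smul_eval]

theorem exists_sq_eval_le_setIntegral {U K : Set (EuclideanSpace ℝ ι)}
    (hUb : Bornology.IsBounded U) (hU : IsOpen U) (hne : U.Nonempty) (hK : IsCompact K) (k : ℕ) :
    ∃ C : ℝ, 0 < C ∧ ∀ p : MvPolynomial ι ℝ, p.totalDegree ≤ k → ∀ x ∈ K,
      eval x p ^ 2 ≤ C * ∫ y in U, eval y p ^ 2 := by
  have : CompactSpace K := isCompact_iff_compactSpace.1 hK
  obtain ⟨C, hC, hbound⟩ :=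
    exists_norm_le_mul_norm_of_injective (injective_evalL2 hUb hU hne k) (evalOn K k)
  refine ⟨C ^ 2, by positivity, fun p hp x hx => ?_⟩
  let q : restrictTotalDegree ι ℝ k := ⟨p, (mem_restrictTotalDegree _ _ _).2 hp⟩
  have hpoint : |eval x p| ≤ C * ‖evalL2 hUb k q‖ :=
    ((evalOn K k q).norm_coe_le_norm ⟨x, hx⟩).trans (hbound q)
  rw [← norm_evalL2_sq hUb q, ← mul_pow, ← sq_abs]
  gcongr

theorem setIntegral_unitBall_comp_add_smul {E F : Type*} [NormedAddCommGroup E] [NormedSpace ℝ E]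
    [MeasurableSpace E] [BorelSpace E] [FiniteDimensional ℝ E] (μ : Measure E) [μ.IsAddHaarMeasure]
    [NormedAddCommGroup F] [NormedSpace ℝ F] (f : E → F) (z : E) {ρ : ℝ} (hρ : 0 < ρ) :
    ∫ y in Metric.ball 0 1, f (z + ρ • y) ∂μ
      = (ρ ^ Module.finrank ℝ E)⁻¹ • ∫ y in Metric.ball z ρ, f y ∂μ := by
  rw [Measure.setIntegral_comp_smul_of_pos μ (fun y => f (z + y)) _ hρ, smul_unitBall_of_pos hρ,
    ← (measurePreserving_add_left μ z).setIntegral_preimage_emb (measurableEmbedding_addLeft z) f,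
    preimage_add_ball, sub_self]

theorem exists_sq_eval_le_setIntegral_ball (k : ℕ) (R : ℝ) :
    ∃ C : ℝ, 0 < C ∧ ∀ p : MvPolynomial ι ℝ, p.totalDegree ≤ k →
      ∀ (z : EuclideanSpace ℝ ι) (ρ : ℝ), 0 < ρ → ∀ x ∈ Metric.closedBall z (R * ρ),
        eval x p ^ 2 ≤ C * (ρ ^ Fintype.card ι)⁻¹ * ∫ y in Metric.ball z ρ, eval y p ^ 2 := by
  obtain ⟨C, hC, hbound⟩ := exists_sq_eval_le_setIntegral (ι := ι) Metric.isBounded_ball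
    Metric.isOpen_ball (Metric.nonempty_ball.2 one_pos) (isCompact_closedBall 0 R) k
  refine ⟨C, hC, fun p hp z ρ hρ x hx => ?_⟩
  obtain ⟨q, hq, hqp⟩ := exists_eval_eq_eval_add_smul p z ρ
  have hmem : ρ⁻¹ • (x - z) ∈ Metric.closedBall (0 : EuclideanSpace ℝ ι) R := by
    rw [mem_closedBall_zero_iff, norm_smul, norm_inv, Real.norm_of_nonneg hρ.le,
      inv_mul_le_iff₀ hρ, mul_comm]
    exact mem_closedBall_iff_norm.1 hx
  have hunit := hbound q (hq.trans hp) _ hmem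
  simp_rw [hqp] at hunit
  rw [smul_inv_smul₀ hρ.ne', add_sub_cancel,
    setIntegral_unitBall_comp_add_smul volume (fun y : EuclideanSpace ℝ ι => eval y p ^ 2) z hρ,
    finrank_euclideanSpace, smul_eq_mul, ← mul_assoc] at hunit
  exact hunit

end InverseEstimate

section Taylor

variable {F : Type*} [NormedAddCommGroup F] [NormedSpace ℝ F]

theorem norm_le_of_norm_deriv_le_pow {f f' : ℝ → F} {K : ℝ} {n : ℕ}
    (hf : ∀ t, HasDerivAt f (f' t) t) (h0 : f 0 = 0) (hf' : ∀ t, 0 ≤ t → ‖f' t‖ ≤ K * t ^ n)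
    {t : ℝ} (ht : 0 ≤ t) : ‖f t‖ ≤ K * (t ^ (n + 1) / (n + 1)) := by
  have hB (s : ℝ) : HasDerivAt (fun s : ℝ => K * (s ^ (n + 1) / (n + 1))) (K * s ^ n) s := by
    refine (((hasDerivAt_pow (n + 1) s).div_const _).const_mul K).congr_deriv ?_
    push_cast
    field_simp
  exact image_norm_le_of_norm_deriv_right_le_deriv_boundary' (a := 0) (b := t)
    (fun s _ => (hf s).continuousAt.continuousWithinAt) (fun s _ => (hf s).hasDerivWithinAt)
    (by simp [h0]) (fun s _ => (hB s).continuousAt.continuousWithinAt)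
    (fun s _ => (hB s).hasDerivWithinAt) (fun s hs => hf' s hs.1) ⟨ht, le_rfl⟩

theorem norm_taylor_one_sub_le {f f' : ℝ → F} {K : ℝ} (hf : ∀ t, HasDerivAt f (f' t) t)
    (hK : ∀ t, 0 ≤ t → ‖f' t - f' 0‖ ≤ K * t) {t : ℝ} (ht : 0 ≤ t) :
    ‖f t - f 0 - t • f' 0‖ ≤ K / 2 * t ^ 2 := by
  have hder (s : ℝ) : HasDerivAt (fun s => f s - f 0 - s • f' 0) (f' s - f' 0) s := by
    simpa using ((hf s).sub_const (f 0)).fun_sub ((hasDerivAt_id s).smul_const (f' 0))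
  refine (norm_le_of_norm_deriv_le_pow (n := 1) hder (by simp) (by simpa using hK) ht).trans_eq ?_
  norm_num
  ring

theorem norm_taylor_two_sub_le {f f' f'' : ℝ → F} {K : ℝ} (hf : ∀ t, HasDerivAt f (f' t) t)
    (hf' : ∀ t, HasDerivAt f' (f'' t) t) (hK : ∀ t, 0 ≤ t → ‖f'' t - f'' 0‖ ≤ K * t)
    {t : ℝ} (ht : 0 ≤ t) :
    ‖f t - f 0 - t • f' 0 - (t ^ 2 / 2) • f'' 0‖ ≤ K / 6 * t ^ 3 := by
  have hder (s : ℝ) : HasDerivAt (fun s => f s - f 0 - s • f' 0 - (s ^ 2 / 2) • f'' 0)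
      (f' s - f' 0 - s • f'' 0) s := by
    have hsq : HasDerivAt (fun s : ℝ => s ^ 2 / 2) s s := by
      simpa using (hasDerivAt_pow 2 s).div_const 2
    simpa using (((hf s).sub_const (f 0)).fun_sub ((hasDerivAt_id s).smul_const (f' 0))).fun_sub
      (hsq.smul_const (f'' 0))
  refine (norm_le_of_norm_deriv_le_pow (n := 2) hder (by simp)
    (fun s hs => norm_taylor_one_sub_le hf' hK hs) ht).trans_eq ?_
  norm_num
  ring

end Taylor
section Newton

variable {X : Type*} [AddCommGroup X] [Module ℝ X]

/-- The functional `J` on `X` has first and second derivatives `dJ` and `ddJ` along lines, and with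
respect to the seminorm `p` the latter is coercive with constant `γ` and Lipschitz continuous with
constant `Λ`. Only directional derivatives occur, so `X` needs no topology. -/
structure HasCoerciveLipschitzHessian (p : Seminorm ℝ X) (γ Λ : ℝ) (J : X → ℝ) (dJ : X → X → ℝ)
    (ddJ : X → X → X → ℝ) : Prop where
  hasDerivAt : ∀ a v t, HasDerivAt (fun t : ℝ => J (a + t • v)) (dJ (a + t • v) v) t
  hasDerivAt_deriv : ∀ a u v t,
    HasDerivAt (fun t : ℝ => dJ (a + t • u) v) (ddJ (a + t • u) u v) t
  add_left : ∀ a u₁ u₂ v, ddJ a (u₁ + u₂) v = ddJ a u₁ v + ddJ a u₂ v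
  coercive : ∀ a v, γ * p v ^ 2 ≤ ddJ a v v
  lipschitz : ∀ a b u v, |ddJ a u v - ddJ b u v| ≤ Λ * p (a - b) * p u * p v

namespace HasCoerciveLipschitzHessian

variable {p : Seminorm ℝ X} {γ Λ σ R : ℝ} {J : X → ℝ} {dJ : X → X → ℝ}
  {ddJ : X → X → X → ℝ} {a b δ : X}

theorem abs_hessian_line_sub_le (hJ : HasCoerciveLipschitzHessian p γ Λ J dJ ddJ) (a u v : X)
    {t : ℝ} (ht : 0 ≤ t) :
    |ddJ (a + t • u) u v - ddJ a u v| ≤ Λ * p u ^ 2 * p v * t := by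
  refine (hJ.lipschitz _ _ u v).trans_eq ?_
  rw [add_sub_cancel_left, map_smul_eq_mul, Real.norm_of_nonneg ht]
  ring

theorem abs_gradient_sub_sub_le (hJ : HasCoerciveLipschitzHessian p γ Λ J dJ ddJ) (a u v : X) :
    |dJ (a + u) v - dJ a v - ddJ a u v| ≤ Λ / 2 * p u ^ 2 * p v := by
  have h := norm_taylor_one_sub_le (fun t => hJ.hasDerivAt_deriv a u v t)
    (fun t ht => by simpa using hJ.abs_hessian_line_sub_le a u v ht) zero_le_one
  simp only [one_smul, zero_smul, add_zero, Real.norm_eq_abs] at h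
  linarith

theorem abs_sub_sub_sub_le (hJ : HasCoerciveLipschitzHessian p γ Λ J dJ ddJ) (a u : X) :
    |J (a + u) - J a - dJ a u - 1 / 2 * ddJ a u u| ≤ Λ / 6 * p u ^ 3 := by
  have h := norm_taylor_two_sub_le (fun t => hJ.hasDerivAt a u t)
    (fun t => hJ.hasDerivAt_deriv a u u t)
    (fun t ht => by simpa using hJ.abs_hessian_line_sub_le a u u ht) zero_le_one
  simp only [one_smul, zero_smul, add_zero, Real.norm_eq_abs, smul_eq_mul, one_pow, one_mul] at h
  exact h.trans_eq (by ring)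

theorem gradient_eq_zero_of_forall_le (hJ : HasCoerciveLipschitzHessian p γ Λ J dJ ddJ)
    (hb : ∀ v, J b ≤ J v) (v : X) : dJ b v = 0 := by
  have hderiv := hJ.hasDerivAt b v 0
  rw [zero_smul, add_zero] at hderiv
  refine IsLocalMin.hasDerivAt_eq_zero (Eventually.of_forall fun t => ?_) hderiv
  simpa only [zero_smul, add_zero] using hb (b + t • v)

theorem newton_error_le (hJ : HasCoerciveLipschitzHessian p γ Λ J dJ ddJ) (hγ : 0 < γ) (hΛ : 0 ≤ Λ)
    (hb : ∀ v, dJ b v = 0) (hδ : ∀ v, ddJ a δ v = -dJ a v) :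
    p (a + δ - b) ≤ Λ / (2 * γ) * p (a - b) ^ 2 := by
  set v := a + δ - b with hv
  -- The gradient at `b` vanishes and `ddJ a δ` cancels the gradient at `a`.
  have hlinear : ddJ a v v = dJ b v - dJ a v - ddJ a (b - a) v := by
    have hsum := hJ.add_left a v (b - a) v
    rw [show v + (b - a) = δ by rw [hv]; abel, hδ] at hsum
    linarith [hb v]
  have htaylor := hJ.abs_gradient_sub_sub_le a (b - a) v
  rw [add_sub_cancel, map_sub_rev] at htaylor
  have hprod : γ * p v * p v ≤ Λ / 2 * p (a - b) ^ 2 * p v := by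
    linarith [hJ.coercive a v, le_of_abs_le htaylor]
  rcases (apply_nonneg p v).eq_or_lt with hzero | hpos
  · rw [← hzero]; positivity
  · have := le_of_mul_le_mul_right hprod hpos
    rw [div_mul_eq_mul_div, le_div_iff₀ (by positivity)]
    linarith

theorem armijo_full_step (hJ : HasCoerciveLipschitzHessian p γ Λ J dJ ddJ) (hσ : σ ≤ 1 / 2)
    (hδ : ddJ a δ δ = -dJ a δ) (hsmall : Λ * p δ ≤ 3 * (γ * (1 - 2 * σ))) :
    J (a + δ) ≤ J a + σ * dJ a δ := by
  have htaylor := le_of_abs_le (hJ.abs_sub_sub_sub_le a δ)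
  have hcoercive := mul_le_mul_of_nonneg_left (hJ.coercive a δ) (by linarith : 0 ≤ 1 / 2 - σ)
  rw [hδ] at htaylor hcoercive
  have hcubic := mul_le_mul_of_nonneg_right hsmall (sq_nonneg (p δ))
  linarith

theorem newton_contraction (hJ : HasCoerciveLipschitzHessian p γ Λ J dJ ddJ) (hγ : 0 < γ)
    (hΛ : 0 ≤ Λ) (hb : ∀ v, dJ b v = 0) (hδ : ∀ v, ddJ a δ v = -dJ a v) (hσ : 0 ≤ σ)
    (hR : Λ * R ≤ γ * (1 - 2 * σ)) (hab : p (a - b) ≤ R) :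
    p (a + δ - b) ≤ p (a - b) / 2 := by
  have hsmall : Λ * p (a - b) ≤ γ := by nlinarith [mul_le_mul_of_nonneg_left hab hΛ]
  calc p (a + δ - b) ≤ Λ / (2 * γ) * p (a - b) ^ 2 := hJ.newton_error_le hγ hΛ hb hδ
    _ = Λ * p (a - b) * (p (a - b) / (2 * γ)) := by ring
    _ ≤ γ * (p (a - b) / (2 * γ)) := by gcongr
    _ = p (a - b) / 2 := by field_simp

theorem armijo_full_step_of_near (hJ : HasCoerciveLipschitzHessian p γ Λ J dJ ddJ) (hγ : 0 < γ)
    (hΛ : 0 ≤ Λ) (hb : ∀ v, dJ b v = 0) (hδ : ∀ v, ddJ a δ v = -dJ a v) (hσ : 0 ≤ σ)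
    (hσ' : σ ≤ 1 / 2) (hR : Λ * R ≤ γ * (1 - 2 * σ)) (hab : p (a - b) ≤ R) :
    J (a + δ) ≤ J a + σ * dJ a δ := by
  have hincrement : p δ ≤ 3 * R :=
    calc p δ = p ((a + δ - b) - (a - b)) := by congr 1; abel
      _ ≤ p (a + δ - b) + p (a - b) := map_sub_le_add p _ _
      _ ≤ 3 * R := by
        linarith [hJ.newton_contraction hγ hΛ hb hδ hσ hR hab, apply_nonneg p (a - b)]
  refine hJ.armijo_full_step hσ' (hδ δ) ?_
  linarith [mul_le_mul_of_nonneg_left hincrement hΛ]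

end HasCoerciveLipschitzHessian

theorem tendsto_zero_of_le_half {e : ℕ → ℝ} {R : ℝ} (he : ∀ n, 0 ≤ e n) (h0 : e 0 ≤ R)
    (hstep : ∀ n, e n ≤ R → e (n + 1) ≤ e n / 2) :
    (∀ n, e n ≤ R) ∧ Tendsto e atTop (𝓝 0) := by
  have hR (n : ℕ) : e n ≤ R := by
    induction n with
    | zero => exact h0
    | succ n ih => linarith [hstep n ih, he n]
  have hgeom (n : ℕ) : e n ≤ (1 / 2) ^ n * e 0 :=
    le_geom (by norm_num) n fun m _ => (hstep m (hR m)).trans_eq (by ring)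
  refine ⟨hR, squeeze_zero he hgeom ?_⟩
  simpa using (tendsto_pow_atTop_nhds_zero_of_lt_one (r := (1 / 2 : ℝ)) (by norm_num)
    (by norm_num)).mul_const (e 0)

theorem exists_newton_radius {γ M σ c A : ℝ} (hγ : 0 < γ) (hM : 0 ≤ M) (hσ : 0 ≤ σ)
    (hσ' : σ < 1 / 2) (hc : 0 ≤ c) (hA : 0 ≤ A) :
    ∃ r : ℝ, 0 < r ∧ M * c * (A * r) ≤ γ * (1 - 2 * σ) ∧
      c * (M * c / (2 * γ) * (A * r) ^ 2) ≤ r := by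
  obtain ⟨r, hr, hsmall⟩ := exists_pos_mul_lt
    (mul_pos hγ (by linarith : 0 < 1 - 2 * σ)) (M * c * A * (1 + c * A))
  have hstep : 0 ≤ M * c * (A * r) := by positivity
  have hstay : 0 ≤ M * c * A * (c * A) * r := by positivity
  have hfactor : M * c * A * (c * A) * r ≤ γ := by nlinarith
  refine ⟨r, hr, by linarith, ?_⟩
  calc c * (M * c / (2 * γ) * (A * r) ^ 2)
      = M * c * A * (c * A) * r / (2 * γ) * r := by ring
    _ ≤ 1 * r := by
        gcongr
        rw [div_le_one (by positivity)]
        linarith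
    _ = r := one_mul r

end Newton
section PolynomialFields

theorem continuous_polyFieldFun (p : PolyField) : Continuous (polyFieldFun p) :=
  (PiLp.continuous_toLp 2 _).comp (continuous_pi fun c => continuous_eval_euclidean (p c))

theorem norm_polyFieldFun_sq (p : PolyField) (x : E3) :
    ‖polyFieldFun p x‖ ^ 2 = ∑ c, polyFun (p c) x ^ 2 := by
  simp [EuclideanSpace.norm_sq_eq, polyFieldFun]

theorem polyFieldFun_add (p q : PolyField) :
    polyFieldFun (p + q) = polyFieldFun p + polyFieldFun q := by
  ext x c
  simp [polyFieldFun, polyFun]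

theorem polyFieldFun_smul (t : ℝ) (p : PolyField) : polyFieldFun (t • p) = t • polyFieldFun p := by
  ext x c
  simp [polyFieldFun, polyFun, MvPolynomial.smul_eval]

theorem polyCurl_add (p q : PolyField) : polyCurl (p + q) = polyCurl p + polyCurl q := by
  funext c
  simp only [polyCurl, Pi.add_apply, map_add]
  abel

theorem polyCurl_smul (t : ℝ) (p : PolyField) : polyCurl (t • p) = t • polyCurl p := by
  funext c
  simp only [polyCurl, Pi.smul_apply, Derivation.map_smul, smul_sub]

theorem exists_sq_norm_polyFieldFun_le (k : ℕ) (R : ℝ) :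
    ∃ C : ℝ, 0 < C ∧ ∀ p : PolyField, (∀ c, (p c).totalDegree ≤ k) →
      ∀ (z : E3) (ρ : ℝ), 0 < ρ → ∀ x ∈ Metric.closedBall z (R * ρ),
        ‖polyFieldFun p x‖ ^ 2
          ≤ C * (ρ ^ 3)⁻¹ * ∫ y in Metric.ball z ρ, ‖polyFieldFun p y‖ ^ 2 := by
  obtain ⟨C, hC, hbound⟩ := exists_sq_eval_le_setIntegral_ball (ι := Fin 3) k R
  refine ⟨C, hC, fun p hp z ρ hρ x hx => ?_⟩
  have hintegrable (c : Fin 3) : IntegrableOn (fun y => polyFun (p c) y ^ 2) (Metric.ball z ρ) :=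
    integrableOn_of_isBounded ((continuous_eval_euclidean (p c)).pow 2) Metric.isBounded_ball
  simp_rw [norm_polyFieldFun_sq]
  rw [integral_finsetSum _ fun c _ => hintegrable c, Finset.mul_sum]
  exact Finset.sum_le_sum fun c _ => hbound (p c) (hp c) z ρ hρ x hx

end PolynomialFields

theorem l2Norm_sq {F : Type*} [NormedAddCommGroup F] (Ω : Set E3) (f : E3 → F) :
    l2Norm Ω f ^ 2 = ∫ x in Ω, ‖f x‖ ^ 2 :=
  Real.sq_sqrt (integral_nonneg fun _ => by positivity)

theorem l2Norm_le_of_linftyNorm_le {Ω : Set E3} (hΩ : Bornology.IsBounded Ω) {F : Type*}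
    [NormedAddCommGroup F] {f : E3 → F} {B : ℝ} (hB : 0 ≤ B)
    (hf : linftyNorm Ω f ≤ ENNReal.ofReal B) :
    l2Norm Ω f ≤ √(volume.real Ω) * B := by
  have hae : ∀ᵐ x ∂volume.restrict Ω, ‖‖f x‖ ^ 2‖ ≤ B ^ 2 := by
    rw [linftyNorm, eLpNorm_exponent_top] at hf
    filter_upwards [ae_le_eLpNormEssSup (f := f) (μ := volume.restrict Ω)] with x hx
    have hx' : ‖f x‖ ≤ B := by
      rw [← ENNReal.ofReal_le_ofReal_iff hB, ofReal_norm]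
      exact hx.trans hf
    rw [norm_pow, norm_norm]
    gcongr
  have hbound := norm_setIntegral_le_of_norm_le_const_ae hΩ.measure_lt_top hae
  rw [l2Norm, ← Real.sqrt_sq hB, ← Real.sqrt_mul measureReal_nonneg, mul_comm]
  exact Real.sqrt_le_sqrt ((Real.le_norm_self _).trans hbound)

namespace Mesh

section Geometry

variable {Ω : Set E3} (𝒯 : Mesh Ω)

theorem refMap_mem_cell (i : Fin 𝒯.N) {y : E3} (hy : y ∈ refTet) : 𝒯.refMap i y ∈ 𝒯.cell i := by
  let W : Fin 4 → ℝ := Fin.cons (1 - ∑ c, y c) y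
  have hcombination : 𝒯.refMap i y = ∑ m, W m • (𝒯.tet i).points m := by
    rw [Fin.sum_univ_succ]
    simp only [W, Fin.cons_zero, Fin.cons_succ, refMap, smul_sub, Finset.sum_sub_distrib, sub_smul,
      one_smul, Finset.sum_smul]
    abel
  rw [hcombination]
  refine (convex_convexHull ℝ _).sum_mem (fun m _ => ?_) (by simp [W, Fin.sum_univ_succ])
    fun m _ => subset_convexHull ℝ _ (Set.mem_range_self m)
  exact Fin.cases (by simpa [W] using hy.2) (fun c => by simpa [W] using hy.1 c) m

theorem cell_subset_closure (i : Fin 𝒯.N) : 𝒯.cell i ⊆ closure Ω :=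
  𝒯.cover ▸ Set.subset_iUnion 𝒯.cell i

theorem isBounded_cell (i : Fin 𝒯.N) : Bornology.IsBounded (𝒯.cell i) :=
  ((Set.finite_range _).isCompact_convexHull ℝ).isBounded

theorem isBounded_domain (𝒯 : Mesh Ω) : Bornology.IsBounded Ω :=
  (Bornology.isBounded_iUnion.2 𝒯.isBounded_cell).subset (𝒯.cover.symm ▸ subset_closure)

theorem hMin_le_diam (i : Fin 𝒯.N) : 𝒯.hMin ≤ Metric.diam (𝒯.cell i) :=
  ciInf_le (Set.finite_range _).bddBelow i

theorem disjoint_interior_cell {i j : Fin 𝒯.N} (hij : i ≠ j) :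
    Disjoint (interior (𝒯.cell i)) (interior (𝒯.cell j)) := by
  -- If the interiors met, the common vertices would span the whole space, so they would be all the
  -- vertices of both elements.
  by_contra h
  rw [Set.not_disjoint_iff_nonempty_inter, ← interior_inter, cell, cell, 𝒯.conforming] at h
  have hspan := affineSpan_eq_top_of_nonempty_interior h
  have hvertices (l : Fin 𝒯.N) (S : Set E3)
      (hS : affineSpan ℝ (Set.range (𝒯.tet l).points ∩ S) = ⊤) :
      Set.range (𝒯.tet l).points ⊆ S := by
    rintro _ ⟨m, rfl⟩
    rw [← Set.image_preimage_eq_range_inter] at hS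
    exact ((𝒯.tet l).independent.mem_affineSpan_iff m _).1 (hS ▸ AffineSubspace.mem_top ℝ E3 _)
  exact 𝒯.distinct i j hij
    ((hvertices i _ hspan).antisymm (hvertices j _ (Set.inter_comm _ _ ▸ hspan)))

theorem glue_eq_of_mem {F : Type*} [AddCommMonoid F] (f : Fin 𝒯.N → E3 → F) {i : Fin 𝒯.N} {x : E3}
    (hx : x ∈ interior (𝒯.cell i)) : 𝒯.glue f x = f i x := by
  rw [glue, Finset.sum_eq_single i, Set.indicator_of_mem hx]
  · intro j _ hj
    exact Set.indicator_of_notMem (fun h => (𝒯.disjoint_interior_cell hj).ne_of_mem h hx rfl) _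
  · simp

theorem glue_eq_zero {F : Type*} [AddCommMonoid F] (f : Fin 𝒯.N → E3 → F) {x : E3}
    (hx : ∀ i, x ∉ interior (𝒯.cell i)) : 𝒯.glue f x = 0 :=
  Finset.sum_eq_zero fun i _ => Set.indicator_of_notMem (hx i) _

theorem comp_glue {F G : Type*} [AddCommMonoid F] [AddCommMonoid G] {g : F → G} (hg : g 0 = 0)
    (f : Fin 𝒯.N → E3 → F) (x : E3) : g (𝒯.glue f x) = 𝒯.glue (fun i y => g (f i y)) x := by
  by_cases h : ∃ i, x ∈ interior (𝒯.cell i)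
  · obtain ⟨i, hi⟩ := h
    rw [𝒯.glue_eq_of_mem f hi, 𝒯.glue_eq_of_mem _ hi]
  · push Not at h
    rw [𝒯.glue_eq_zero f h, 𝒯.glue_eq_zero _ h, hg]

theorem norm_glue_le {F : Type*} [NormedAddCommGroup F] {f : Fin 𝒯.N → E3 → F} {B : ℝ} (hB : 0 ≤ B)
    (hf : ∀ i, ∀ x ∈ 𝒯.cell i, ‖f i x‖ ≤ B) (x : E3) : ‖𝒯.glue f x‖ ≤ B := by
  by_cases h : ∃ i, x ∈ interior (𝒯.cell i)
  · obtain ⟨i, hi⟩ := h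
    rw [𝒯.glue_eq_of_mem f hi]
    exact hf i x (_root_.interior_subset hi)
  · push Not at h
    rwa [𝒯.glue_eq_zero f h, norm_zero]

theorem linftyNorm_glue_le {F : Type*} [NormedAddCommGroup F] {f : Fin 𝒯.N → E3 → F} {B : ℝ}
    (hB : 0 ≤ B) (hf : ∀ i, ∀ x ∈ 𝒯.cell i, ‖f i x‖ ≤ B) :
    linftyNorm Ω (𝒯.glue f) ≤ ENNReal.ofReal B := by
  rw [linftyNorm, eLpNorm_exponent_top]
  exact eLpNormEssSup_le_of_ae_bound (Eventually.of_forall (𝒯.norm_glue_le hB hf))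

theorem setIntegral_interior_cell_le_l2Norm_glue_sq {F : Type*} [NormedAddCommGroup F]
    {f : Fin 𝒯.N → E3 → F} (hf : ∀ i, Continuous (f i)) (i : Fin 𝒯.N) :
    ∫ x in interior (𝒯.cell i), ‖f i x‖ ^ 2 ≤ l2Norm Ω (𝒯.glue f) ^ 2 := by
  have hintegrable : Integrable fun x => ‖𝒯.glue f x‖ ^ 2 := by
    simp_rw [𝒯.comp_glue (g := fun y : F => ‖y‖ ^ 2) (by simp) f]
    exact integrable_finsetSum _ fun j _ =>
      (integrable_indicator_iff isOpen_interior.measurableSet).2 <|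
        integrableOn_of_isBounded ((hf j).norm.pow 2)
          ((𝒯.isBounded_cell j).subset _root_.interior_subset)
  calc ∫ x in interior (𝒯.cell i), ‖f i x‖ ^ 2
      = ∫ x in interior (𝒯.cell i), ‖𝒯.glue f x‖ ^ 2 :=
        setIntegral_congr_fun isOpen_interior.measurableSet fun x hx => by
          simp only [𝒯.glue_eq_of_mem f hx]
    _ ≤ ∫ x in Ω, ‖𝒯.glue f x‖ ^ 2 :=
        setIntegral_mono_set hintegrable.integrableOn (Eventually.of_forall fun _ => by positivity)
          (𝒯.interior_subset i).eventuallyLE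
    _ = l2Norm Ω (𝒯.glue f) ^ 2 := (l2Norm_sq Ω _).symm

end Geometry

section InverseEstimate

theorem exists_sq_norm_polyFieldFun_le_setIntegral_cell (k : ℕ) (κ : ℝ) :
    ∃ C : ℝ, 0 < C ∧ ∀ {Ω : Set E3} {𝒯 : Mesh Ω} {h : ℝ}, 𝒯.IsShapeRegular κ → 0 < h →
      h ≤ 𝒯.hMin → ∀ p : PolyField, (∀ c, (p c).totalDegree ≤ k) → ∀ i, ∀ x ∈ 𝒯.cell i,
        ‖polyFieldFun p x‖ ^ 2
          ≤ C * (h ^ 3)⁻¹ * ∫ y in interior (𝒯.cell i), ‖polyFieldFun p y‖ ^ 2 := by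
  obtain ⟨C, hC, hbound⟩ := exists_sq_norm_polyFieldFun_le k (2 * max κ 1)
  refine ⟨C * (2 * max κ 1) ^ 3, by positivity, ?_⟩
  intro Ω 𝒯 h hκ hh hmin p hp i x hx
  obtain ⟨z, ρ, hρ, hball, hdiam⟩ := hκ i
  have hdiam' : Metric.diam (𝒯.cell i) ≤ 2 * max κ 1 * ρ := by
    nlinarith [mul_le_mul_of_nonneg_right (le_max_left κ 1) hρ.le]
  have hx' : x ∈ Metric.closedBall z (2 * max κ 1 * ρ) :=
    (Metric.dist_le_diam_of_mem (𝒯.isBounded_cell i) hx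
      (hball (Metric.mem_closedBall_self hρ.le))).trans hdiam'
  have hsub : Metric.ball z ρ ⊆ interior (𝒯.cell i) :=
    interior_maximal (Metric.ball_subset_closedBall.trans hball) Metric.isOpen_ball
  have hscale : (ρ ^ 3)⁻¹ ≤ (2 * max κ 1) ^ 3 * (h ^ 3)⁻¹ := by
    rw [← div_eq_mul_inv, ← div_pow, ← inv_pow]
    gcongr
    rw [inv_le_iff_one_le_mul₀ hρ, div_mul_eq_mul_div, one_le_div hh]
    exact (hmin.trans (𝒯.hMin_le_diam i)).trans hdiam'
  calc ‖polyFieldFun p x‖ ^ 2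
      ≤ C * (ρ ^ 3)⁻¹ * ∫ y in Metric.ball z ρ, ‖polyFieldFun p y‖ ^ 2 := hbound p hp z ρ hρ x hx'
    _ ≤ C * ((2 * max κ 1) ^ 3 * (h ^ 3)⁻¹)
          * ∫ y in interior (𝒯.cell i), ‖polyFieldFun p y‖ ^ 2 := by
        refine mul_le_mul (by gcongr) (setIntegral_mono_set ?_
          (Eventually.of_forall fun _ => by positivity) hsub.eventuallyLE)
          (integral_nonneg fun _ => by positivity) (by positivity)
        exact integrableOn_of_isBounded ((continuous_polyFieldFun p).norm.pow 2)
          ((𝒯.isBounded_cell i).subset _root_.interior_subset)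
    _ = _ := by rw [← mul_assoc]

theorem exists_norm_polyFieldFun_le_l2Norm (k : ℕ) (κ : ℝ) :
    ∃ C : ℝ, 0 < C ∧ ∀ {Ω : Set E3} {𝒯 : Mesh Ω} {h : ℝ}, 𝒯.IsShapeRegular κ → 0 < h →
      h ≤ 𝒯.hMin → ∀ v : 𝒯.PwField, 𝒯.IsPwDegreeLE k v → ∀ i, ∀ x ∈ 𝒯.cell i,
        ‖polyFieldFun (v i) x‖ ≤ C * h ^ (-(3 / 2) : ℝ) * l2Norm Ω (𝒯.fieldFun v) := by
  obtain ⟨C, hC, hbound⟩ := exists_sq_norm_polyFieldFun_le_setIntegral_cell k κ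
  refine ⟨√C, Real.sqrt_pos.2 hC, fun {Ω 𝒯 h} hκ hh hmin v hv i x hx => ?_⟩
  have hpow : (h ^ (-(3 / 2) : ℝ)) ^ 2 = (h ^ 3)⁻¹ := by
    rw [← Real.rpow_natCast, ← Real.rpow_mul hh.le, ← Real.rpow_natCast h 3,
      ← Real.rpow_neg hh.le]
    norm_num
  have hl : 0 ≤ l2Norm Ω (𝒯.fieldFun v) := Real.sqrt_nonneg _
  refine le_of_sq_le_sq ?_ (by positivity)
  rw [mul_pow, mul_pow, Real.sq_sqrt hC.le, hpow]
  exact (hbound hκ hh hmin (v i) (hv i) i x hx).trans <| mul_le_mul_of_nonneg_left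
    (𝒯.setIntegral_interior_cell_le_l2Norm_glue_sq (fun j => continuous_polyFieldFun (v j)) i)
    (by positivity)

end InverseEstimate

end Mesh
namespace Mesh

section Quadrature

variable {Ω : Set E3} {𝒯 : Mesh Ω} {Q : QuadRule} {k : ℕ}

theorem quad_mono (hQ : 𝒯.IsAdmissibleRule Q k) {f g : Fin 𝒯.N → E3 → ℝ}
    (hfg : ∀ i, ∀ x ∈ 𝒯.cell i, f i x ≤ g i x) : 𝒯.quad Q f ≤ 𝒯.quad Q g := by
  refine Finset.sum_le_sum fun i _ => Finset.sum_le_sum fun j _ => ?_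
  have hpoint := hfg i _ (𝒯.refMap_mem_cell i (hQ.mem_refTet j))
  have hwt := (hQ.wt_pos j).le
  have hvol : 0 ≤ 𝒯.cellVol i := ENNReal.toReal_nonneg
  gcongr

theorem hasDerivAt_quad (hQ : 𝒯.IsAdmissibleRule Q k) {f : ℝ → Fin 𝒯.N → E3 → ℝ}
    {f' : Fin 𝒯.N → E3 → ℝ} {t : ℝ}
    (hf : ∀ i, ∀ x ∈ 𝒯.cell i, HasDerivAt (fun s => f s i x) (f' i x) t) :
    HasDerivAt (fun s => 𝒯.quad Q (f s)) (𝒯.quad Q f') t :=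
  HasDerivAt.fun_sum fun i _ => HasDerivAt.fun_sum fun j _ =>
    ((hf i _ (𝒯.refMap_mem_cell i (hQ.mem_refTet j))).mul_const _).mul_const _

/-- The values of a piecewise field at the quadrature nodes, scaled by the square roots of the
weights so that the Euclidean inner product of such vectors is the discrete scalar product. -/
noncomputable def nodeVec (𝒯 : Mesh Ω) (Q : QuadRule) :
    (Fin 𝒯.N → E3 → E3) →ₗ[ℝ] PiLp 2 fun _ : Fin 𝒯.N × Fin Q.card => E3 where
  toFun f := WithLp.toLp 2 fun n =>
    √(Q.wt n.2 * 𝒯.cellVol n.1) • f n.1 (𝒯.refMap n.1 (Q.pt n.2))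
  map_add' f g := by ext n : 1; simp
  map_smul' t f := by ext n : 1; simp [smul_comm t]

theorem inner_nodeVec (hQ : 𝒯.IsAdmissibleRule Q k) (f g : Fin 𝒯.N → E3 → E3) :
    inner ℝ (𝒯.nodeVec Q f) (𝒯.nodeVec Q g) = 𝒯.innerH Q f g := by
  rw [PiLp.inner_apply, Fintype.sum_prod_type]
  refine Finset.sum_congr rfl fun i _ => Finset.sum_congr rfl fun j _ => ?_
  have hweight : 0 ≤ Q.wt j * 𝒯.cellVol i := mul_nonneg (hQ.wt_pos j).le ENNReal.toReal_nonneg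
  simp only [nodeVec, LinearMap.coe_mk, AddHom.coe_mk, real_inner_smul_left, real_inner_smul_right]
  rw [← mul_assoc, Real.mul_self_sqrt hweight]
  ring

theorem norm_nodeVec_sq (hQ : 𝒯.IsAdmissibleRule Q k) (f : Fin 𝒯.N → E3 → E3) :
    ‖𝒯.nodeVec Q f‖ ^ 2 = 𝒯.quad Q fun i x => ‖f i x‖ ^ 2 := by
  simp_rw [← real_inner_self_eq_norm_sq]
  exact inner_nodeVec hQ f f

theorem norm_nodeVec_le (hQ : 𝒯.IsAdmissibleRule Q k) {f g : Fin 𝒯.N → E3 → E3} {B : ℝ}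
    (hB : 0 ≤ B) (hfg : ∀ i, ∀ x ∈ 𝒯.cell i, ‖f i x‖ ≤ B * ‖g i x‖) :
    ‖𝒯.nodeVec Q f‖ ≤ B * ‖𝒯.nodeVec Q g‖ := by
  rw [← Real.norm_of_nonneg hB, ← norm_smul, ← map_smul]
  refine le_of_sq_le_sq ?_ (norm_nonneg _)
  rw [norm_nodeVec_sq hQ, norm_nodeVec_sq hQ]
  refine quad_mono hQ fun i x hx => ?_
  rw [Pi.smul_apply, Pi.smul_apply, norm_smul, Real.norm_of_nonneg hB]
  gcongr
  exact hfg i x hx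

/-- The elementwise curl as a linear map. -/
noncomputable def curlOnLinear (𝒯 : Mesh Ω) : 𝒯.PwField →ₗ[ℝ] Fin 𝒯.N → E3 → E3 where
  toFun := 𝒯.curlOn
  map_add' u v := by
    funext i
    simp only [curlOn, Pi.add_apply, polyCurl_add, polyFieldFun_add]
  map_smul' t v := by
    funext i
    simp only [curlOn, Pi.smul_apply, polyCurl_smul, polyFieldFun_smul, RingHom.id_apply]

theorem curlOn_add (u v : 𝒯.PwField) : 𝒯.curlOn (u + v) = 𝒯.curlOn u + 𝒯.curlOn v :=
  map_add 𝒯.curlOnLinear u v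

theorem curlOn_sub (u v : 𝒯.PwField) : 𝒯.curlOn (u - v) = 𝒯.curlOn u - 𝒯.curlOn v :=
  map_sub 𝒯.curlOnLinear u v

theorem hasDerivAt_curlOn (a v : 𝒯.PwField) (i : Fin 𝒯.N) (x : E3) (t : ℝ) :
    HasDerivAt (fun s : ℝ => 𝒯.curlOn (a + s • v) i x) (𝒯.curlOn v i x) t := by
  have hline (s : ℝ) : 𝒯.curlOn (a + s • v) i x = 𝒯.curlOn a i x + s • 𝒯.curlOn v i x := by
    simp only [← show ⇑𝒯.curlOnLinear = 𝒯.curlOn from rfl, map_add, map_smul, Pi.add_apply,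
      Pi.smul_apply]
  simp_rw [hline]
  simpa using ((hasDerivAt_id t).smul_const (𝒯.curlOn v i x)).const_add (𝒯.curlOn a i x)

/-- The seminorm `⟨curl v, curl v⟩_h ^ (1/2)` on piecewise polynomial fields. -/
noncomputable def curlSeminorm (𝒯 : Mesh Ω) (Q : QuadRule) : Seminorm ℝ 𝒯.PwField :=
  (normSeminorm ℝ _).comp (𝒯.nodeVec Q ∘ₗ 𝒯.curlOnLinear)

theorem curlSeminorm_apply (v : 𝒯.PwField) :
    𝒯.curlSeminorm Q v = ‖𝒯.nodeVec Q (𝒯.curlOn v)‖ := rfl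

theorem curlSeminorm_eq_l2Norm (hQ : 𝒯.IsAdmissibleRule Q k) {v : 𝒯.PwField}
    (hv : 𝒯.IsPwDegreeLE k (𝒯.pwCurl v)) : 𝒯.curlSeminorm Q v = l2Norm Ω (𝒯.curlFun v) := by
  rw [curlSeminorm_apply, ← Real.sqrt_sq (norm_nonneg _), ← real_inner_self_eq_norm_sq,
    inner_nodeVec hQ]
  refine congrArg Real.sqrt ((hQ.exact _ _ hv hv).trans ?_)
  simp only [real_inner_self_eq_norm_sq]
  rfl

end Quadrature

section Energy

variable {Ω : Set E3} {𝒯 : Mesh Ω} {Q : QuadRule} {k : ℕ} {w : E3 → E3 → ℝ}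
  {hs : Fin 𝒯.N → E3 → E3} {V : Submodule ℝ 𝒯.PwField} {γ M c : ℝ}

/-- The second derivative `⟨∂_bb w(curl a) curl u, curl v⟩_h` of the energy at `a` in the directions
`u` and `v`. -/
noncomputable def energyHessian (𝒯 : Mesh Ω) (Q : QuadRule) (w : E3 → E3 → ℝ) (a u v : 𝒯.PwField) :
    ℝ :=
  𝒯.innerH Q (fun i x => ddw w x (𝒯.curlOn a i x) (𝒯.curlOn u i x)) (𝒯.curlOn v)

theorem energy_eq_quad (v : 𝒯.PwField) :
    𝒯.energy Q w hs v
      = 𝒯.quad Q fun i x => w x (𝒯.curlOn v i x) - inner ℝ (hs i x) (𝒯.curlOn v i x) := by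
  simp only [energy, innerH, quad, sub_mul, Finset.sum_sub_distrib]

theorem hasDerivAt_energy (hQ : 𝒯.IsAdmissibleRule Q k)
    (hw : ∀ x ∈ closure Ω, ContDiff ℝ 2 (w x)) (a v : 𝒯.PwField) (t : ℝ) :
    HasDerivAt (fun s : ℝ => 𝒯.energy Q w hs (a + s • v)) (𝒯.residual Q w hs (a + t • v) v) t := by
  simp_rw [energy_eq_quad]
  refine hasDerivAt_quad hQ
    (f' := fun i x => inner ℝ (dw w x (𝒯.curlOn (a + t • v) i x) - hs i x) (𝒯.curlOn v i x))
    (f := fun s i x => w x (𝒯.curlOn (a + s • v) i x) - inner ℝ (hs i x) (𝒯.curlOn (a + s • v) i x))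
    fun i x hx => ?_
  have hcurl := hasDerivAt_curlOn a v i x t
  have hgradient := ((hw x (𝒯.cell_subset_closure i hx)).differentiable two_ne_zero
    (𝒯.curlOn (a + t • v) i x)).hasGradientAt.hasFDerivAt.comp_hasDerivAt t hcurl
  refine (hgradient.fun_sub ((hasDerivAt_const t (hs i x)).inner ℝ hcurl)).congr_deriv ?_
  simp [dw, inner_sub_left]

theorem hasDerivAt_residual (hQ : 𝒯.IsAdmissibleRule Q k)
    (hw : ∀ x ∈ closure Ω, ContDiff ℝ 2 (w x)) (a u v : 𝒯.PwField) (t : ℝ) :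
    HasDerivAt (fun s : ℝ => 𝒯.residual Q w hs (a + s • u) v)
      (𝒯.energyHessian Q w (a + t • u) u v) t := by
  refine hasDerivAt_quad hQ
    (f := fun s i x => inner ℝ (dw w x (𝒯.curlOn (a + s • u) i x) - hs i x) (𝒯.curlOn v i x))
    (f' := fun i x =>
      inner ℝ (ddw w x (𝒯.curlOn (a + t • u) i x) (𝒯.curlOn u i x)) (𝒯.curlOn v i x))
    fun i x hx => ?_
  have hdw : Differentiable ℝ (gradient (w x)) :=
    ((InnerProductSpace.toDual ℝ E3).symm.contDiff.comp
      ((hw x (𝒯.cell_subset_closure i hx)).fderiv_right le_rfl)).differentiable one_ne_zero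
  have hcurl := (hdw _).hasFDerivAt.comp_hasDerivAt t (hasDerivAt_curlOn a u i x t)
  refine ((hcurl.sub_const (hs i x)).inner ℝ
    (hasDerivAt_const t (𝒯.curlOn v i x))).congr_deriv ?_
  simp [ddw]

theorem energyHessian_coercive (hQ : 𝒯.IsAdmissibleRule Q k)
    (hlower : ∀ x ∈ closure Ω, ∀ η ξ : E3, γ * ‖ξ‖ ^ 2 ≤ inner ℝ (ddw w x η ξ) ξ)
    (a v : 𝒯.PwField) : γ * 𝒯.curlSeminorm Q v ^ 2 ≤ 𝒯.energyHessian Q w a v v := by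
  have hscale : γ * 𝒯.curlSeminorm Q v ^ 2 = 𝒯.quad Q fun i x => γ * ‖𝒯.curlOn v i x‖ ^ 2 := by
    rw [curlSeminorm_apply, norm_nodeVec_sq hQ]
    simp only [quad, Finset.mul_sum, mul_assoc]
  rw [hscale]
  exact quad_mono hQ fun i x hx => hlower x (𝒯.cell_subset_closure i hx) _ _

theorem abs_energyHessian_sub_le (hQ : 𝒯.IsAdmissibleRule Q k) (hwM : HasLipschitzHessian Ω M w)
    (hM : 0 ≤ M) {a b : 𝒯.PwField} {B : ℝ} (hB : 0 ≤ B)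
    (hab : ∀ i, ∀ x ∈ 𝒯.cell i, ‖𝒯.curlOn (a - b) i x‖ ≤ B) (u v : 𝒯.PwField) :
    |𝒯.energyHessian Q w a u v - 𝒯.energyHessian Q w b u v|
      ≤ M * B * 𝒯.curlSeminorm Q u * 𝒯.curlSeminorm Q v := by
  simp only [energyHessian, ← inner_nodeVec hQ, ← inner_sub_left, ← map_sub]
  refine (abs_real_inner_le_norm _ _).trans
    (mul_le_mul_of_nonneg_right (norm_nodeVec_le hQ (by positivity) fun i x hx => ?_)
      (norm_nonneg _))
  calc ‖ddw w x (𝒯.curlOn a i x) (𝒯.curlOn u i x) - ddw w x (𝒯.curlOn b i x) (𝒯.curlOn u i x)‖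
      ≤ ‖ddw w x (𝒯.curlOn a i x) - ddw w x (𝒯.curlOn b i x)‖ * ‖𝒯.curlOn u i x‖ :=
        (ddw w x (𝒯.curlOn a i x) - ddw w x (𝒯.curlOn b i x)).le_opNorm _
    _ ≤ M * ‖𝒯.curlOn (a - b) i x‖ * ‖𝒯.curlOn u i x‖ := by
        rw [curlOn_sub]
        gcongr
        exact hwM x (𝒯.cell_subset_closure i hx) _ _
    _ ≤ M * B * ‖𝒯.curlOn u i x‖ := by
        gcongr
        exact hab i x hx

theorem hasCoerciveLipschitzHessian_energy (hQ : 𝒯.IsAdmissibleRule Q k)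
    (hw : ∀ x ∈ closure Ω, ContDiff ℝ 2 (w x))
    (hlower : ∀ x ∈ closure Ω, ∀ η ξ : E3, γ * ‖ξ‖ ^ 2 ≤ inner ℝ (ddw w x η ξ) ξ)
    (hwM : HasLipschitzHessian Ω M w) (hM : 0 ≤ M) (hc : 0 ≤ c)
    (hinverse : ∀ v ∈ V, ∀ i, ∀ x ∈ 𝒯.cell i, ‖𝒯.curlOn v i x‖ ≤ c * 𝒯.curlSeminorm Q v) :
    HasCoerciveLipschitzHessian ((𝒯.curlSeminorm Q).comp V.subtype) γ (M * c)
      (fun v => 𝒯.energy Q w hs v) (fun a v => 𝒯.residual Q w hs a v)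
      (fun a u v => 𝒯.energyHessian Q w a u v) where
  hasDerivAt a v t := hasDerivAt_energy hQ hw a v t
  hasDerivAt_deriv a u v t := hasDerivAt_residual hQ hw a u v t
  add_left a u₁ u₂ v := by
    simp only [energyHessian, ← inner_nodeVec hQ, ← inner_add_left, ← map_add]
    congr 2
    funext i x
    simp only [Submodule.coe_add, curlOn_add, Pi.add_apply, map_add]
  coercive a v := energyHessian_coercive hQ hlower a v
  lipschitz a b u v := by
    rw [mul_assoc M]
    exact abs_energyHessian_sub_le hQ hwM hM (by positivity) (hinverse (a - b) (a - b).2) u v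

end Energy

section DampedNewton

variable {Ω : Set E3} {𝒯 : Mesh Ω} {Q : QuadRule} {w : E3 → E3 → ℝ} {hs : Fin 𝒯.N → E3 → E3}
  {V : Submodule ℝ 𝒯.PwField} {γ Λ ρ σ R : ℝ} {ah : 𝒯.PwField} {a δ : ℕ → 𝒯.PwField} {τ : ℕ → ℝ}
  {p : Seminorm ℝ 𝒯.PwField}

theorem IsArmijoStep.eq_one {b v : 𝒯.PwField} {t : ℝ} (ht : 𝒯.IsArmijoStep Q w hs ρ σ b v t)
    (hρ : 0 ≤ ρ) (hρ1 : ρ ≤ 1)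
    (hfull : 𝒯.energy Q w hs (b + v) ≤ 𝒯.energy Q w hs b + σ * 𝒯.residual Q w hs b v) :
    t = 1 := by
  obtain ⟨⟨⟨m, rfl⟩, -⟩, hmax⟩ := ht
  exact le_antisymm (pow_le_one₀ hρ hρ1)
    (hmax ⟨⟨0, (pow_zero ρ).symm⟩, by simpa only [one_smul, mul_one] using hfull⟩)

theorem IsDampedNewton.mem (hN : 𝒯.IsDampedNewton Q w hs V ρ σ a δ τ) (n : ℕ) : a n ∈ V := by
  induction n with
  | zero => exact hN.init
  | succ n ih =>
    rw [hN.update]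
    exact V.add_mem ih (V.smul_mem _ (hN.increment n).1)

theorem IsDampedNewton.full_step (hN : 𝒯.IsDampedNewton Q w hs V ρ σ a δ τ)
    (hah : 𝒯.IsDiscreteSolution Q w hs V ah)
    (hJ : HasCoerciveLipschitzHessian (p.comp V.subtype) γ Λ (fun v => 𝒯.energy Q w hs v)
      (fun b v => 𝒯.residual Q w hs b v) (fun b u v => 𝒯.energyHessian Q w b u v))
    (hγ : 0 < γ) (hΛ : 0 ≤ Λ) (hρ : 0 ≤ ρ) (hρ1 : ρ ≤ 1) (hσ : 0 ≤ σ) (hσ' : σ ≤ 1 / 2)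
    (hR : Λ * R ≤ γ * (1 - 2 * σ)) {n : ℕ} (hn : p (a n - ah) ≤ R) :
    τ n = 1 ∧ p (a (n + 1) - ah) ≤ Λ / (2 * γ) * p (a n - ah) ^ 2 ∧
      p (a (n + 1) - ah) ≤ p (a n - ah) / 2 := by
  let b : V := ⟨ah, hah.1⟩
  let x : V := ⟨a n, hN.mem n⟩
  let v : V := ⟨δ n, (hN.increment n).1⟩
  have hb := hJ.gradient_eq_zero_of_forall_le (b := b) fun y => hah.2 y y.2
  have hv (y : V) : 𝒯.energyHessian Q w x v y = -𝒯.residual Q w hs x y :=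
    (hN.increment n).2 y y.2
  have harmijo : 𝒯.energy Q w hs (x + v : V) ≤ 𝒯.energy Q w hs x + σ * 𝒯.residual Q w hs x v :=
    hJ.armijo_full_step_of_near (a := x) (δ := v) hγ hΛ hb hv hσ hσ' hR hn
  have hτ : τ n = 1 := (hN.step n).eq_one hρ hρ1 harmijo
  rw [hN.update, hτ, one_smul]
  exact ⟨rfl, hJ.newton_error_le (a := x) (δ := v) hγ hΛ hb hv,
    hJ.newton_contraction (a := x) (δ := v) hγ hΛ hb hv hσ hR hn⟩

theorem IsDampedNewton.full_steps_and_tendsto (hN : 𝒯.IsDampedNewton Q w hs V ρ σ a δ τ)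
    (hah : 𝒯.IsDiscreteSolution Q w hs V ah)
    (hJ : HasCoerciveLipschitzHessian (p.comp V.subtype) γ Λ (fun v => 𝒯.energy Q w hs v)
      (fun b v => 𝒯.residual Q w hs b v) (fun b u v => 𝒯.energyHessian Q w b u v))
    (hγ : 0 < γ) (hΛ : 0 ≤ Λ) (hρ : 0 ≤ ρ) (hρ1 : ρ ≤ 1) (hσ : 0 ≤ σ) (hσ' : σ ≤ 1 / 2)
    (hR : Λ * R ≤ γ * (1 - 2 * σ)) {n : ℕ} (hn : p (a n - ah) ≤ R) :
    (∀ m ≥ n, p (a m - ah) ≤ R ∧ τ m = 1 ∧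
      p (a (m + 1) - ah) ≤ Λ / (2 * γ) * p (a m - ah) ^ 2) ∧
    Tendsto (fun m => p (a m - ah)) atTop (𝓝 0) := by
  have hstep {m : ℕ} (hm : p (a m - ah) ≤ R) :=
    hN.full_step hah hJ hγ hΛ hρ hρ1 hσ hσ' hR hm
  obtain ⟨hnear, hlim⟩ := tendsto_zero_of_le_half (e := fun j => p (a (j + n) - ah)) (R := R)
    (fun j => apply_nonneg p _) (by simpa only [zero_add] using hn)
    (fun j hj => by simpa only [add_right_comm] using (hstep hj).2.2)
  refine ⟨fun m hm => ?_, (tendsto_add_atTop_iff_nat n).1 hlim⟩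
  have hm' : p (a m - ah) ≤ R := by simpa only [Nat.sub_add_cancel hm] using hnear (m - n)
  exact ⟨hm', (hstep hm').1, (hstep hm').2.1⟩

end DampedNewton

section LocalConvergence

variable {Ω : Set E3} {𝒯 : Mesh Ω} {Q : QuadRule} {k : ℕ} {w : E3 → E3 → ℝ}
  {hs : Fin 𝒯.N → E3 → E3} {V : Submodule ℝ 𝒯.PwField} {γ M c ρ σ r : ℝ} {ah : 𝒯.PwField}
  {a δ : ℕ → 𝒯.PwField} {τ : ℕ → ℝ}

theorem IsDampedNewton.local_quadratic_convergence (hN : 𝒯.IsDampedNewton Q w hs V ρ σ a δ τ)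
    (hah : 𝒯.IsDiscreteSolution Q w hs V ah) (hQ : 𝒯.IsAdmissibleRule Q k)
    (hV : ∀ v ∈ V, 𝒯.IsPwDegreeLE k (𝒯.pwCurl v)) (hw : ∀ x ∈ closure Ω, ContDiff ℝ 2 (w x))
    (hlower : ∀ x ∈ closure Ω, ∀ η ξ : E3, γ * ‖ξ‖ ^ 2 ≤ inner ℝ (ddw w x η ξ) ξ)
    (hwM : HasLipschitzHessian Ω M w) (hγ : 0 < γ) (hM : 0 ≤ M) (hρ : 0 ≤ ρ) (hρ1 : ρ ≤ 1)
    (hσ : 0 ≤ σ) (hσ' : σ ≤ 1 / 2) (hc : 0 ≤ c)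
    (hinverse : ∀ v ∈ V, ∀ i, ∀ x ∈ 𝒯.cell i, ‖𝒯.curlOn v i x‖ ≤ c * l2Norm Ω (𝒯.curlFun v))
    (hr : 0 ≤ r) (hstep : M * c * (√(volume.real Ω) * r) ≤ γ * (1 - 2 * σ))
    (hstay : c * (M * c / (2 * γ) * (√(volume.real Ω) * r) ^ 2) ≤ r) {n : ℕ}
    (hn : linftyNorm Ω (𝒯.curlFun (a n - ah)) ≤ ENNReal.ofReal r) :
    (τ n = 1 ∧ l2Norm Ω (𝒯.curlFun (a (n + 1) - ah))
      ≤ M * c / (2 * γ) * l2Norm Ω (𝒯.curlFun (a n - ah)) ^ 2) ∧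
    (∀ m ≥ n, linftyNorm Ω (𝒯.curlFun (a m - ah)) ≤ ENNReal.ofReal r) ∧
    Tendsto (fun m => l2Norm Ω (𝒯.curlFun (a m - ah))) atTop (𝓝 0) := by
  have hl2 {v : 𝒯.PwField} (hv : v ∈ V) := curlSeminorm_eq_l2Norm hQ (hV v hv)
  have hJ := hasCoerciveLipschitzHessian_energy (hs := hs) hQ hw hlower hwM hM hc
    fun v hv => (hl2 hv).symm ▸ hinverse v hv
  have herror (m : ℕ) : a m - ah ∈ V := V.sub_mem (hN.mem m) hah.1
  have hn2 : 𝒯.curlSeminorm Q (a n - ah) ≤ √(volume.real Ω) * r :=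
    (hl2 (herror n)).trans_le (l2Norm_le_of_linftyNorm_le 𝒯.isBounded_domain hr hn)
  obtain ⟨hnewton, hlim⟩ :=
    hN.full_steps_and_tendsto hah hJ hγ (mul_nonneg hM hc) hρ hρ1 hσ hσ' hstep hn2
  simp only [hl2 (herror _)] at hnewton hlim
  refine ⟨(hnewton n le_rfl).2, fun m hm => ?_, hlim⟩
  obtain rfl | ⟨m, hmn, rfl⟩ : m = n ∨ ∃ l ≥ n, m = l + 1 := by
    rcases hm.eq_or_lt with h | h
    · exact .inl h.symm
    · exact .inr ⟨m - 1, by omega, by omega⟩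
  · exact hn
  obtain ⟨hnear, -, hquadratic⟩ := hnewton m hmn
  refine 𝒯.linftyNorm_glue_le hr fun i x hx => (hinverse _ (herror _) i x hx).trans ?_
  refine le_trans (mul_le_mul_of_nonneg_left (hquadratic.trans ?_) hc) hstay
  gcongr
  exact Real.sqrt_nonneg _

end LocalConvergence

end Mesh

section Nedelec

variable {k : ℕ}

theorem IsNedelec.totalDegree_le {v : PolyField} (hv : IsNedelec k v) (c : Fin 3) :
    (v c).totalDegree ≤ k + 1 := by
  obtain ⟨p, q, hp, hq, rfl⟩ := hv
  have hmul (i j : Fin 3) : ((MvPolynomial.X i : Poly) * q j).totalDegree ≤ k + 1 :=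
    calc ((MvPolynomial.X i : Poly) * q j).totalDegree
        ≤ (MvPolynomial.X i : Poly).totalDegree + (q j).totalDegree :=
          MvPolynomial.totalDegree_mul _ _
      _ ≤ 1 + k := add_le_add (MvPolynomial.totalDegree_X i).le (hq j).totalDegree_le
      _ = k + 1 := add_comm 1 k
  refine (MvPolynomial.totalDegree_add _ _).trans (max_le ((hp c).trans k.le_succ) ?_)
  rw [cross_apply]
  fin_cases c <;> exact (MvPolynomial.totalDegree_sub _ _).trans (max_le (hmul _ _) (hmul _ _))

theorem IsNedelec.totalDegree_polyCurl_le {v : PolyField} (hv : IsNedelec k v) (c : Fin 3) :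
    (polyCurl v c).totalDegree ≤ k := by
  have hpderiv (i j : Fin 3) : (MvPolynomial.pderiv i (v j)).totalDegree ≤ k :=
    (totalDegree_pderiv_le i (v j)).trans (Nat.sub_le_of_le_add (hv.totalDegree_le j))
  exact (MvPolynomial.totalDegree_sub _ _).trans (max_le (hpderiv _ _) (hpderiv _ _))

namespace Mesh

variable {Ω : Set E3} {𝒯 : Mesh Ω}

theorem zero_mem_lagrangeSpace (k : ℕ) : (0 : Fin 𝒯.N → Poly) ∈ 𝒯.lagrangeSpace k := by
  have hglue : (𝒯.glue fun i => polyFun ((0 : Fin 𝒯.N → Poly) i)) = 0 := by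
    funext x
    refine Finset.sum_eq_zero fun i _ => Set.indicator_apply_eq_zero.2 fun _ => ?_
    simp [polyFun]
  have htest : IsTest Ω (0 : E3 → ℝ) :=
    ⟨contDiff_const, HasCompactSupport.zero, by simp [tsupport]⟩
  refine ⟨fun i => by simp, ?_⟩
  rw [hglue]
  refine ⟨MemLp.zero', 0, fun i => ⟨MemLp.zero', fun φ _ => by simp⟩, fun ε hε => ?_⟩
  refine ⟨0, htest, ?_, fun i => ?_⟩
  · simpa [l2Norm] using hε
  · simpa [l2Norm, partialDeriv] using hε

theorem IsStableComplement.isNedelec {V : Submodule ℝ 𝒯.PwField} (hV : 𝒯.IsStableComplement k V)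
    {v : 𝒯.PwField} (hv : v ∈ V) (i : Fin 𝒯.N) : IsNedelec k (v i) := by
  have hgrad : 𝒯.pwGrad 0 = 0 := by
    funext i c
    simp [pwGrad, polyGrad]
  have hmem : v ∈ 𝒯.nedelecSpace k := by
    rw [hV.sum]
    exact ⟨0, zero_mem_lagrangeSpace k, v, hv, by rw [hgrad, zero_add]⟩
  exact hmem.1 i

end Mesh

end Nedelec

end Magnetostatics

theorem theorem5_general (k : ℕ) (κ : ℝ) :
    ∃ C : ℝ, 0 < C ∧
      ∀ (Ω : Set Magnetostatics.E3) (γ M σ h : ℝ), 0 < γ → 0 ≤ M → 0 ≤ σ → σ < 1 / 2 → 0 < h →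
      ∃ r : ℝ, 0 < r ∧
        ∀ (𝒯 : Magnetostatics.Mesh Ω) (Q : Magnetostatics.QuadRule)
          (w : Magnetostatics.E3 → Magnetostatics.E3 → ℝ)
          (hs : Fin 𝒯.N → Magnetostatics.E3 → Magnetostatics.E3)
          (V : Submodule ℝ 𝒯.PwField) (ah : 𝒯.PwField)
          (ρ : ℝ) (a δ : ℕ → 𝒯.PwField) (τ : ℕ → ℝ),
          𝒯.IsShapeRegular κ → h ≤ 𝒯.hMin →
          𝒯.IsAdmissibleRule Q k →
          (∀ v ∈ V, 𝒯.IsPwDegreeLE k (𝒯.pwCurl v)) →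
          (∀ x ∈ closure Ω, ContDiff ℝ 2 (w x)) →
          (∀ x ∈ closure Ω, ∀ η ξ : Magnetostatics.E3,
            γ * ‖ξ‖ ^ 2 ≤ inner ℝ (Magnetostatics.ddw w x η ξ) ξ) →
          Magnetostatics.HasLipschitzHessian Ω M w →
          𝒯.IsDiscreteSolution Q w hs V ah →
          0 ≤ ρ → ρ ≤ 1 →
          𝒯.IsDampedNewton Q w hs V ρ σ a δ τ →
          ∀ n : ℕ,
            Magnetostatics.linftyNorm Ω (𝒯.curlFun (a n - ah)) ≤ ENNReal.ofReal r →
            (τ n = 1 ∧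
              Magnetostatics.l2Norm Ω (𝒯.curlFun (a (n + 1) - ah))
                ≤ C * (M / γ) * h ^ (-(3 / 2) : ℝ)
                    * Magnetostatics.l2Norm Ω (𝒯.curlFun (a n - ah)) ^ 2) ∧
            (∀ m ≥ n,
              Magnetostatics.linftyNorm Ω (𝒯.curlFun (a m - ah)) ≤ ENNReal.ofReal r) ∧
            Tendsto (fun m => Magnetostatics.l2Norm Ω (𝒯.curlFun (a m - ah))) atTop (𝓝 0) := by
  obtain ⟨C, hC, hinverse⟩ := Magnetostatics.Mesh.exists_norm_polyFieldFun_le_l2Norm k κ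
  refine ⟨C / 2, half_pos hC, fun Ω γ M σ h hγ hM hσ hσ' hh => ?_⟩
  have hc : 0 ≤ C * h ^ (-(3 / 2) : ℝ) := by positivity
  obtain ⟨r, hr, hstep, hstay⟩ := Magnetostatics.exists_newton_radius hγ hM hσ hσ' hc
    (Real.sqrt_nonneg (volume.real Ω))
  refine ⟨r, hr, fun 𝒯 Q w hs V ah ρ a δ τ hκ hmin hQ hV hw hlower hwM hah hρ hρ1 hN n hn => ?_⟩
  have hconv := hN.local_quadratic_convergence hah hQ hV hw hlower hwM hγ hM hρ hρ1 hσ hσ'.le hc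
    (fun v hv => hinverse hκ hh hmin (𝒯.pwCurl v) (hV v hv)) hr.le hstep hstay hn
  have hconst : M * (C * h ^ (-(3 / 2) : ℝ)) / (2 * γ) = C / 2 * (M / γ) * h ^ (-(3 / 2) : ℝ) := by
    ring
  rwa [hconst] at hconv

theorem theorem5 (k : ℕ) (κ : ℝ) :
    ∃ C : ℝ, 0 < C ∧
      ∀ (Ω : Set Magnetostatics.E3), Magnetostatics.IsAdmissibleDomain Ω →
      ∀ (γ L M ρ σ h : ℝ), 0 < γ → 0 < L → 0 ≤ M → 0 < ρ → ρ ≤ 1 / 2 → 0 < σ → σ < 1 / 2 →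
        0 < h →
      ∃ r : ℝ, 0 < r ∧
        ∀ (𝒯 : Magnetostatics.Mesh Ω) (Q : Magnetostatics.QuadRule)
          (w : Magnetostatics.E3 → Magnetostatics.E3 → ℝ)
          (hs : Fin 𝒯.N → Magnetostatics.E3 → Magnetostatics.E3)
          (V : Submodule ℝ 𝒯.PwField) (ah : 𝒯.PwField)
          (a δ : ℕ → 𝒯.PwField) (τ : ℕ → ℝ),
          𝒯.IsShapeRegular κ → 𝒯.hMin = h →
          𝒯.IsAdmissibleRule Q k →
          𝒯.IsStableComplement k V →
          𝒯.IsSource hs →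
          Magnetostatics.IsAdmissibleEnergy Ω γ L w →
          Magnetostatics.HasLipschitzHessian Ω M w →
          𝒯.IsDiscreteSolution Q w hs V ah →
          𝒯.IsDampedNewton Q w hs V ρ σ a δ τ →
          ∀ n : ℕ,
            Magnetostatics.linftyNorm Ω (𝒯.curlFun (a n - ah)) ≤ ENNReal.ofReal r →
            (τ n = 1 ∧
              Magnetostatics.l2Norm Ω (𝒯.curlFun (a (n + 1) - ah))
                ≤ C * (M / γ) * h ^ (-(3 / 2) : ℝ)
                    * Magnetostatics.l2Norm Ω (𝒯.curlFun (a n - ah)) ^ 2) ∧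
            (∀ m ≥ n,
              Magnetostatics.linftyNorm Ω (𝒯.curlFun (a m - ah)) ≤ ENNReal.ofReal r) ∧
            Tendsto (fun m => Magnetostatics.l2Norm Ω (𝒯.curlFun (a m - ah))) atTop (𝓝 0) := by
  obtain ⟨C, hC, hgeneral⟩ := theorem5_general k κ
  refine ⟨C, hC, fun Ω _ γ L M ρ σ h hγ _ hM hρ hρ1 hσ hσ' hh => ?_⟩
  obtain ⟨r, hr, hconv⟩ := hgeneral Ω γ M σ h hγ hM hσ.le hσ' hh
  exact ⟨r, hr, fun 𝒯 Q w hs V ah a δ τ hκ hmin hQ hV _ hw hwM hah hN =>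
    hconv 𝒯 Q w hs V ah ρ a δ τ hκ hmin.ge hQ
      (fun v hv i => (hV.isNedelec hv i).totalDegree_polyCurl_le) hw.contDiff hw.lower hwM hah hρ.le
      (by linarith) hN⟩
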